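/- All graphs are finite, simple and have at least one vertex. A realisation of a graph $G=(V,E)$ is a map $p:V\to\mathbb{R}^2$; it is generic if its $2|V|$ coordinates are algebraically independent over $\mathbb{Q}$. Two realisations $p,q$ of $G$ are equivalent if $\|p(x)-p(y)\|=\|q(x)-q(y)\|$ for every edge $xy\in E$, and congruent if this equality holds for all $x,y\in V$. A realisation $p$ of $G$ is globally rigid if every realisation of $G$ equivalent to $p$ is congruent to $p$; it is rigid if there is $\varepsilon>0$ such that every realisation $q$ of $G$ that is equivalent to $p$ and satisfies $\|q(x)-p(x)\|<\varepsilon$ for all $x\in V$ is congruent to $p$. The graph $G$ is globally rigid (respectively, rigid) if it has a generic realisation that is globally rigid (respectively, rigid). Lemma. Let $G$ be a graph. (i) $G$ is cubic (that is, 3-regular) and globally rigid if and only if $G$ is isomorphic to the complete graph $K_4$. (ii) $G$ is cubic, rigid and not globally rigid if and only if $G$ is isomorphic either to the complete bipartite graph $K_{3,3}$ or to the triangular prism, i.e. the Cartesian product of $K_2$ and $K_3$ (two disjoint triangles joined by a perfect matching). -/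

import Mathlib

/-- A realisation of a graph with vertex set `V`: any map from `V` to the Euclidean plane. -/
abbrev Realisation (V : Type*) : Type _ := V → EuclideanSpace ℝ (Fin 2)

namespace Realisation

variable {V : Type*}

/-- Two realisations of `G` are equivalent if all edges have the same length in both.
(Congruence, i.e. agreement of all pairwise distances, is Mathlib's `Congruent`.) -/
def Equivalent (G : SimpleGraph V) (p q : Realisation V) : Prop :=
  ∀ x y : V, G.Adj x y → ‖p x - p y‖ = ‖q x - q y‖

/-- `p` is generic if its `2|V|` coordinates are algebraically independent over `ℚ`. -/
def Generic (p : Realisation V) : Prop :=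
  AlgebraicIndependent ℚ (fun c : V × Fin 2 => p c.1 c.2)

/-- Every equivalent realisation is congruent to `p`. -/
def GloballyRigid (G : SimpleGraph V) (p : Realisation V) : Prop :=
  ∀ q : Realisation V, Equivalent G p q → Congruent p q

/-- Every equivalent realisation sufficiently close to `p` is congruent to `p`. -/
def Rigid (G : SimpleGraph V) (p : Realisation V) : Prop :=
  ∃ ε : ℝ, 0 < ε ∧ ∀ q : Realisation V,
    Equivalent G p q → (∀ x : V, ‖q x - p x‖ < ε) → Congruent p q

end Realisation

/-- A graph is globally rigid (in the plane) if it has a globally rigid generic realisation. -/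
def SimpleGraph.IsGloballyRigid {V : Type*} (G : SimpleGraph V) : Prop :=
  ∃ p : Realisation V, p.Generic ∧ p.GloballyRigid G

/-- A graph is rigid (in the plane) if it has a rigid generic realisation. -/
def SimpleGraph.IsRigid {V : Type*} (G : SimpleGraph V) : Prop :=
  ∃ p : Realisation V, p.Generic ∧ p.Rigid G

open scoped Matrix

/-! ### Realisations in coordinates -/

/-! Rigidity bounds the number of edges from below. If $|E|+3<2|V|$, the rigidity matrix with three
pinning rows, taken over the polynomial ring, has a nonzero kernel vector. It is a polynomial vector
field tangent to the fibres of the edge length map. Its integral curve through a rigid generic $p$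
consists of realisations equivalent to $p$, hence congruent to $p$ for small times. So the field
vanishes at $p$, and by genericity it vanishes identically, a contradiction
(`Realisation.Generic.card_edgeSet`). For a cubic graph $2|E|=3|V|$, so $|V|$ is 4 or 6. On six
vertices the graph is the prism or $K_{3,3}$, according to whether it has a triangle.

Conversely, infinitesimal rigidity is the nonvanishing of a rational polynomial, so one explicit
placement of each six-vertex graph makes every generic placement infinitesimally rigid, hence rigid.
Complete graphs are trivially globally rigid.

It remains to give every generic realisation of the two six-vertex graphs an equivalent,
noncongruent one. Both arguments use a one-parameter linkage and a function `circleDefect` that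
detects when three circles meet, so that its zeros are candidates for closing the linkage up.
Infinitesimal rigidity makes the original zero simple, hence a sign change, and sign changes along a
closed curve come in pairs. For the prism the curve is the rotation of one triangle
(`exists_other_prism_realisation`). For $K_{3,3}$ two vertices $b_0,b_1$ of one side are placed at
varying distance $s$ and the other side takes all choices of reflection. The branches are glued
where a triangle degenerates (`BipartiteLinkage.exists_other_realisation`). -/

lemma EuclideanSpace.norm_sub_eq_norm_sub_iff (a b c d : EuclideanSpace ℝ (Fin 2)) :
    ‖a - b‖ = ‖c - d‖ ↔
      (a 0 - b 0) ^ 2 + (a 1 - b 1) ^ 2 = (c 0 - d 0) ^ 2 + (c 1 - d 1) ^ 2 := by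
  rw [EuclideanSpace.norm_eq, EuclideanSpace.norm_eq, Real.sqrt_inj (by positivity) (by positivity)]
  simp [Fin.sum_univ_two]

namespace Realisation

variable {V : Type*}

lemma equivalent_iff (G : SimpleGraph V) (p q : Realisation V) :
    Equivalent G p q ↔ ∀ x y, G.Adj x y →
      (p x 0 - p y 0) ^ 2 + (p x 1 - p y 1) ^ 2 = (q x 0 - q y 0) ^ 2 + (q x 1 - q y 1) ^ 2 := by
  simp only [Equivalent, EuclideanSpace.norm_sub_eq_norm_sub_iff]

lemma congruent_iff (p q : Realisation V) :
    Congruent p q ↔ ∀ x y,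
      (p x 0 - p y 0) ^ 2 + (p x 1 - p y 1) ^ 2 = (q x 0 - q y 0) ^ 2 + (q x 1 - q y 1) ^ 2 := by
  simp only [congruent_iff_dist_eq, dist_eq_norm, EuclideanSpace.norm_sub_eq_norm_sub_iff]

lemma GloballyRigid.rigid {G : SimpleGraph V} {p : Realisation V} (h : p.GloballyRigid G) :
    p.Rigid G :=
  ⟨1, one_pos, fun q hq _ => h q hq⟩

/-! ### Generic realisations -/

lemma Generic.aeval_ne_zero {p : Realisation V} (hp : p.Generic) {P : MvPolynomial (V × Fin 2) ℚ}
    (hP : P ≠ 0) : MvPolynomial.aeval (fun c : V × Fin 2 => p c.1 c.2) P ≠ 0 := fun h =>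
  hP (algebraicIndependent_iff.1 hp P h)

/-- A rational polynomial that does not vanish somewhere does not vanish at a generic point. -/
lemma Generic.aeval_ne_zero_of {p : Realisation V} (hp : p.Generic)
    {P : MvPolynomial (V × Fin 2) ℚ} (m : V × Fin 2 → ℝ) (hP : MvPolynomial.aeval m P ≠ 0) :
    MvPolynomial.aeval (fun c : V × Fin 2 => p c.1 c.2) P ≠ 0 :=
  hp.aeval_ne_zero fun h => hP (by rw [h, map_zero])

/-- A transcendence basis of ℝ over ℚ is infinite, since otherwise ℝ would be algebraic over a
countable ring and so countable. Distinct basis elements serve as coordinates. -/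
lemma exists_generic (V : Type*) [Finite V] : ∃ p : Realisation V, p.Generic := by
  obtain ⟨s, hs⟩ := exists_isTranscendenceBasis ℚ ℝ
  have hinf : Infinite s := by
    by_contra hfin
    rw [not_infinite_iff_finite] at hfin
    have halg := hs.isAlgebraic
    have hcount : Countable (Algebra.adjoin ℚ (Set.range ((↑) : s → ℝ))) := by
      have : Countable (MvPolynomial s ℚ) := Cardinal.mk_le_aleph0_iff.1
        (MvPolynomial.cardinalMk_le_max.trans (by simp))
      exact Countable.of_equiv _ hs.1.aevalEquiv.toEquiv
    have hle := Algebra.IsAlgebraic.cardinalMk_le_max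
      (Algebra.adjoin ℚ (Set.range ((↑) : s → ℝ))) ℝ
    rw [max_eq_right (Cardinal.mk_le_aleph0_iff.2 hcount), Cardinal.mk_real] at hle
    exact absurd hle (not_le.2 Cardinal.aleph0_lt_continuum)
  obtain ⟨f⟩ : Nonempty (V × Fin 2 ↪ s) := by
    cases nonempty_fintype V
    exact ⟨(Fintype.equivFin _).toEmbedding.trans ((Fin.valEmbedding).trans
      (Infinite.natEmbedding s))⟩
  refine ⟨fun v => WithLp.toLp 2 fun i => (f (v, i) : ℝ), ?_⟩
  exact hs.1.comp f f.injective

/-- The polynomial whose vanishing expresses that three points are collinear. -/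
lemma Generic.cross_ne_zero {p : Realisation V} (hp : p.Generic) {x y z : V} (hxy : x ≠ y)
    (hxz : x ≠ z) (hyz : y ≠ z) :
    (p y 0 - p x 0) * (p z 1 - p x 1) - (p z 0 - p x 0) * (p y 1 - p x 1) ≠ 0 := by
  classical
  have := hp.aeval_ne_zero_of (P := (.X (y, 0) - .X (x, 0)) * (.X (z, 1) - .X (x, 1)) -
      (.X (z, 0) - .X (x, 0)) * (.X (y, 1) - .X (x, 1)))
    -- Test placement: `x` at the origin, `y` at $(1,0)$, `z` at $(0,1)$.
    (fun c => if c = (y, 0) then 1 else if c = (z, 1) then 1 else 0)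
    (by simp [hxy, hxz, hyz.symm, hyz])
  simpa using this

end Realisation

/-! ### Infinitesimal rigidity -/

section RigidityMatrix

variable {V : Type*} {A : Type*} [CommRing A]

/-- Rows are indexed by the edges of `G` and by three further conditions that pin the vertex `u`
and the first coordinate of the vertex `w`. -/
noncomputable def SimpleGraph.pinnedRigidityMatrix [DecidableEq V] (G : SimpleGraph V) (u w : V)
    (m : V × Fin 2 → A) : Matrix (G.edgeSet ⊕ Fin 3) (V × Fin 2) A :=
  Matrix.of <| Sum.elim
    (fun e c => (m ((Quot.out e.1).1, c.2) - m ((Quot.out e.1).2, c.2)) *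
      ((if c.1 = (Quot.out e.1).1 then 1 else 0) - (if c.1 = (Quot.out e.1).2 then 1 else 0)))
    (fun i c => if c = (![(u, 0), (u, 1), (w, 0)] : Fin 3 → V × Fin 2) i then 1 else 0)

lemma SimpleGraph.pinnedRigidityMatrix_map [DecidableEq V] (G : SimpleGraph V) {B : Type*}
    [CommRing B] (f : A →+* B) (u w : V) (m : V × Fin 2 → A) :
    (G.pinnedRigidityMatrix u w m).map f = G.pinnedRigidityMatrix u w (f ∘ m) := by
  ext i c
  rcases i with e | i
  · simp [pinnedRigidityMatrix, apply_ite f]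
  · simp [pinnedRigidityMatrix, apply_ite f]

variable [Fintype V] [DecidableEq V] (G : SimpleGraph V)

lemma SimpleGraph.pinnedRigidityMatrix_mulVec_inl (u w : V) (m v : V × Fin 2 → A)
    (e : G.edgeSet) :
    (G.pinnedRigidityMatrix u w m *ᵥ v) (.inl e) =
      (m ((Quot.out e.1).1, 0) - m ((Quot.out e.1).2, 0)) *
        (v ((Quot.out e.1).1, 0) - v ((Quot.out e.1).2, 0)) +
      (m ((Quot.out e.1).1, 1) - m ((Quot.out e.1).2, 1)) *
        (v ((Quot.out e.1).1, 1) - v ((Quot.out e.1).2, 1)) := by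
  simp only [pinnedRigidityMatrix, Matrix.mulVec, dotProduct, Matrix.of_apply, Sum.elim_inl,
    Fintype.sum_prod_type, Fin.sum_univ_two, Finset.sum_add_distrib]
  simp only [mul_assoc, ← Finset.mul_sum]
  simp [sub_mul, Finset.sum_sub_distrib]

lemma SimpleGraph.pinnedRigidityMatrix_mulVec_inr (u w : V) (m v : V × Fin 2 → A) (i : Fin 3) :
    (G.pinnedRigidityMatrix u w m *ᵥ v) (.inr i) =
      v ((![(u, 0), (u, 1), (w, 0)] : Fin 3 → V × Fin 2) i) := by
  simp [pinnedRigidityMatrix, Matrix.mulVec, dotProduct]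

lemma SimpleGraph.pinnedRigidityMatrix_mulVec_eq_zero_iff (u w : V) (m v : V × Fin 2 → A) :
    G.pinnedRigidityMatrix u w m *ᵥ v = 0 ↔
      (∀ x y, G.Adj x y → (m (x, 0) - m (y, 0)) * (v (x, 0) - v (y, 0)) +
        (m (x, 1) - m (y, 1)) * (v (x, 1) - v (y, 1)) = 0) ∧
      v (u, 0) = 0 ∧ v (u, 1) = 0 ∧ v (w, 0) = 0 := by
  constructor
  · intro h
    refine ⟨fun x y hxy => ?_, ?_, ?_, ?_⟩
    · have := congrFun h (.inl ⟨s(x, y), hxy⟩)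
      rw [pinnedRigidityMatrix_mulVec_inl, Pi.zero_apply] at this
      have hq : s((Quot.out s(x, y)).1, (Quot.out s(x, y)).2) = s(x, y) := Quot.out_eq _
      -- `Quot.out` may list the endpoints in either order. This is harmless because swapping them
      -- changes the sign of both factors.
      rcases Sym2.eq_iff.1 hq with ⟨h1, h2⟩ | ⟨h1, h2⟩
      · simpa only [h1, h2] using this
      · simp only [h1, h2] at this
        linear_combination this
    · simpa [pinnedRigidityMatrix_mulVec_inr] using congrFun h (.inr 0)
    · simpa [pinnedRigidityMatrix_mulVec_inr] using congrFun h (.inr 1)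
    · simpa [pinnedRigidityMatrix_mulVec_inr] using congrFun h (.inr 2)
  · rintro ⟨h, h0, h1, h2⟩
    funext i
    rcases i with e | i
    · rw [pinnedRigidityMatrix_mulVec_inl]
      refine h _ _ ?_
      have hq : s((Quot.out e.1).1, (Quot.out e.1).2) = e.1 := Quot.out_eq _
      rw [← SimpleGraph.mem_edgeSet, hq]
      exact e.2
    · rw [pinnedRigidityMatrix_mulVec_inr]
      fin_cases i <;> simp [h0, h1, h2]

/-- The pinned rigidity matrix has trivial kernel. -/
def SimpleGraph.PinnedRigid (u w : V) (m : V × Fin 2 → ℝ) : Prop :=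
  ∀ v, G.pinnedRigidityMatrix u w m *ᵥ v = 0 → v = 0

/-- The Gram determinant of the pinned rigidity matrix. -/
noncomputable def SimpleGraph.rigidityGramDet [Fintype G.edgeSet] (u w : V) (m : V × Fin 2 → A) :
    A :=
  Matrix.det (Matrix.transpose (G.pinnedRigidityMatrix u w m) * G.pinnedRigidityMatrix u w m)

/-- Subtracting a trivial motion makes any infinitesimal motion a pinned one. -/
lemma SimpleGraph.PinnedRigid.infinitesimal {u w : V} {m : V × Fin 2 → ℝ}
    (hm : G.PinnedRigid u w m) (huw : m (w, 1) ≠ m (u, 1)) {v : V × Fin 2 → ℝ}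
    (hv : ∀ x y, G.Adj x y → (m (x, 0) - m (y, 0)) * (v (x, 0) - v (y, 0)) +
        (m (x, 1) - m (y, 1)) * (v (x, 1) - v (y, 1)) = 0) (x y : V) :
    (m (x, 0) - m (y, 0)) * (v (x, 0) - v (y, 0)) +
        (m (x, 1) - m (y, 1)) * (v (x, 1) - v (y, 1)) = 0 := by
  -- Angular speed of the rotation about `u` that cancels the first velocity coordinate of `w`
  -- relative to `u`.
  set t := (v (w, 0) - v (u, 0)) / (m (w, 1) - m (u, 1)) with ht
  have ht' : t * (m (w, 1) - m (u, 1)) = v (w, 0) - v (u, 0) :=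
    div_mul_cancel₀ _ (sub_ne_zero.2 huw)
  let v' : V × Fin 2 → ℝ := fun c => if c.2 = 0
    then v (c.1, 0) - v (u, 0) - t * (m (c.1, 1) - m (u, 1))
    else v (c.1, 1) - v (u, 1) + t * (m (c.1, 0) - m (u, 0))
  have h0 : ∀ x, v' (x, 0) = v (x, 0) - v (u, 0) - t * (m (x, 1) - m (u, 1)) := fun x => rfl
  have h1 : ∀ x, v' (x, 1) = v (x, 1) - v (u, 1) + t * (m (x, 0) - m (u, 0)) := fun x => rfl
  have hz : v' = 0 := by
    apply hm
    rw [pinnedRigidityMatrix_mulVec_eq_zero_iff]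
    refine ⟨fun x y hxy => ?_, ?_, ?_, ?_⟩
    · rw [h0, h0, h1, h1]
      linear_combination hv x y hxy
    · rw [h0]; ring
    · rw [h1]; ring
    · rw [h0, ht']; ring
  have hz0 : ∀ x, v (x, 0) = v (u, 0) + t * (m (x, 1) - m (u, 1)) := fun x => by
    have := congrFun hz (x, 0)
    rw [h0, Pi.zero_apply] at this
    linear_combination this
  have hz1 : ∀ x, v (x, 1) = v (u, 1) - t * (m (x, 0) - m (u, 0)) := fun x => by
    have := congrFun hz (x, 1)
    rw [h1, Pi.zero_apply] at this
    linear_combination this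
  rw [hz0 x, hz0 y, hz1 x, hz1 y]
  ring

variable [Fintype G.edgeSet]

/-- Over ℝ, $M^TMv=0$ forces $|Mv|^2=0$. The Gram determinant thus replaces the maximal minors by a
single polynomial, whatever the number of rows. -/
lemma SimpleGraph.pinnedRigid_iff_det_ne_zero (u w : V) (m : V × Fin 2 → ℝ) :
    G.PinnedRigid u w m ↔
      G.rigidityGramDet u w m ≠ 0 := by
  rw [rigidityGramDet, ← not_iff_not, not_not, ← Matrix.exists_mulVec_eq_zero_iff]
  simp only [PinnedRigid, not_forall]
  constructor
  · rintro ⟨v, hv, h0⟩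
    exact ⟨v, h0, by rw [← Matrix.mulVec_mulVec, hv, Matrix.mulVec_zero]⟩
  · rintro ⟨v, h0, hv⟩
    refine ⟨v, ?_, h0⟩
    rw [← Matrix.mulVec_mulVec] at hv
    rw [← dotProduct_self_eq_zero]
    rw [Matrix.dotProduct_mulVec, ← Matrix.mulVec_transpose, hv, zero_dotProduct]

/-- The Gram determinant is a rational polynomial in the coordinates. If it is nonzero at a single
placement `m`, it is nonzero at every generic one. -/
lemma Realisation.Generic.pinnedRigid {p : Realisation V} (hp : p.Generic) (u w : V)
    {m : V × Fin 2 → ℝ} (hm : G.PinnedRigid u w m) :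
    G.PinnedRigid u w (fun c => p c.1 c.2) := by
  rw [G.pinnedRigid_iff_det_ne_zero] at hm ⊢
  have key : ∀ m : V × Fin 2 → ℝ, MvPolynomial.aeval m
      (G.rigidityGramDet u w (MvPolynomial.X (R := ℚ))) = G.rigidityGramDet u w m := by
    intro m
    have := G.pinnedRigidityMatrix_map
      (MvPolynomial.aeval m : MvPolynomial (V × Fin 2) ℚ →ₐ[ℚ] ℝ).toRingHom u w MvPolynomial.X
    have h2 : (⇑(MvPolynomial.aeval m : MvPolynomial (V × Fin 2) ℚ →ₐ[ℚ] ℝ).toRingHom ∘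
        MvPolynomial.X) = m := by
      funext c; simp
    rw [h2] at this
    rw [SimpleGraph.rigidityGramDet, SimpleGraph.rigidityGramDet, AlgHom.map_det,
      AlgHom.mapMatrix_apply, Matrix.map_mul, Matrix.transpose_map, ← this]
    rfl
  rw [← key] at hm ⊢
  exact hp.aeval_ne_zero_of m hm

lemma SimpleGraph.isOpen_pinnedRigid (u w : V) : IsOpen {m | G.PinnedRigid u w m} := by
  have : {m | G.PinnedRigid u w m} = {m | G.rigidityGramDet u w m ≠ 0} := by
    ext m; exact G.pinnedRigid_iff_det_ne_zero u w m
  rw [this]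
  refine isOpen_ne_fun (Continuous.matrix_det ?_) continuous_const
  have hc : Continuous fun m : V × Fin 2 → ℝ => G.pinnedRigidityMatrix u w m := by
    refine continuous_matrix fun i c => ?_
    rcases i with e | i
    · simp only [pinnedRigidityMatrix, Matrix.of_apply, Sum.elim_inl]
      fun_prop
    · simp only [pinnedRigidityMatrix, Matrix.of_apply, Sum.elim_inr]
      fun_prop
  exact hc.matrix_transpose.matrix_mul hc

/-- Infinitesimal rigidity implies rigidity: if `q` is equivalent to `p`, then `q - p` is an
infinitesimal motion of the midpoint realisation. -/
lemma SimpleGraph.PinnedRigid.rigid {u w : V} {p : Realisation V}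
    (hm : G.PinnedRigid u w (fun c => p c.1 c.2)) (huw : p w 1 ≠ p u 1) : p.Rigid G := by
  have hopen : IsOpen {q : Realisation V |
      G.PinnedRigid u w (fun c => (p c.1 c.2 + q c.1 c.2) / 2) ∧
        (p w 1 + q w 1) / 2 ≠ (p u 1 + q u 1) / 2} := by
    refine IsOpen.inter ((G.isOpen_pinnedRigid u w).preimage ?_) (isOpen_ne_fun ?_ ?_) <;> fun_prop
  obtain ⟨ε, hε, hball⟩ := Metric.isOpen_iff.1 hopen p ⟨by simpa using hm, by simpa using huw⟩
  refine ⟨ε, hε, fun q hq hclose => ?_⟩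
  have hmem : q ∈ Metric.ball p ε := by
    rw [Metric.mem_ball, dist_pi_lt_iff hε]
    intro x
    rw [dist_eq_norm]
    exact hclose x
  obtain ⟨h1, h2⟩ := hball hmem
  rw [Realisation.equivalent_iff] at hq
  rw [Realisation.congruent_iff]
  intro x y
  -- Difference of squares: $|Q|^2-|P|^2=2(Q-P)\cdot\frac{P+Q}{2}$ for $P=p_x-p_y$ and $Q=q_x-q_y$.
  have := h1.infinitesimal G h2 (v := fun c => q c.1 c.2 - p c.1 c.2) (fun x y hxy => by
    simp only
    linear_combination -hq x y hxy / 2) x y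
  simp only at this
  linear_combination -2 * this

end RigidityMatrix

/-! ### Flexes of graphs with few edges -/

section Flex

variable {V : Type*}

/-- A pinned infinitesimal motion that preserves all distances to first order vanishes. -/
lemma Realisation.Generic.eq_zero_of_pinned {p : Realisation V} (hp : p.Generic) {u w : V}
    (huw : u ≠ w) {v : V × Fin 2 → ℝ} (hu0 : v (u, 0) = 0) (hu1 : v (u, 1) = 0)
    (hw0 : v (w, 0) = 0)
    (hv : ∀ x y, (p x 0 - p y 0) * (v (x, 0) - v (y, 0)) +
      (p x 1 - p y 1) * (v (x, 1) - v (y, 1)) = 0) : v = 0 := by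
  classical
  have hne : p w 1 - p u 1 ≠ 0 := by
    have := hp.aeval_ne_zero_of (P := .X (w, 1) - .X (u, 1))
      (fun c => if c = (w, 1) then 1 else 0) (by simp [huw])
    simpa using this
  have hw1 : v (w, 1) = 0 := by
    have := hv w u
    rw [hu0, hu1, hw0] at this
    have h : (p w 1 - p u 1) * v (w, 1) = 0 := by linear_combination this
    exact (mul_eq_zero.1 h).resolve_left hne
  have hall : ∀ x, v (x, 0) = 0 ∧ v (x, 1) = 0 := by
    intro x
    by_cases hxu : x = u
    · subst hxu; exact ⟨hu0, hu1⟩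
    by_cases hxw : x = w
    · subst hxw; exact ⟨hw0, hw1⟩
    have h := hp.cross_ne_zero hxu hxw huw
    have e1 := hv x u
    have e2 := hv x w
    rw [hu0, hu1] at e1
    rw [hw0, hw1] at e2
    constructor
    · refine (mul_eq_zero.1 ?_).resolve_left h
      linear_combination -(p w 1 - p x 1) * e1 + (p u 1 - p x 1) * e2
    · refine (mul_eq_zero.1 ?_).resolve_left h
      linear_combination (p w 0 - p x 0) * e1 - (p u 0 - p x 0) * e2
  funext ⟨x, i⟩
  fin_cases i
  · exact (hall x).1
  · exact (hall x).2

variable [Fintype V] (G : SimpleGraph V) [Fintype G.edgeSet]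

/-- If there are too few edges, there is a polynomial vector field tangent to the fibres of the
edge length map. -/
lemma SimpleGraph.exists_polynomial_motion (u w : V)
    (hcard : Fintype.card G.edgeSet + 3 < 2 * Fintype.card V) :
    ∃ v : V × Fin 2 → MvPolynomial (V × Fin 2) ℚ, v ≠ 0 ∧
      (∀ x y, G.Adj x y → (.X (x, 0) - .X (y, 0)) * (v (x, 0) - v (y, 0)) +
        (.X (x, 1) - .X (y, 1)) * (v (x, 1) - v (y, 1)) = 0) ∧
      v (u, 0) = 0 ∧ v (u, 1) = 0 ∧ v (w, 0) = 0 := by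
  classical
  set M := G.pinnedRigidityMatrix u w (MvPolynomial.X (R := ℚ)) with hM
  by_contra hcon
  have hinj : Function.Injective M.mulVecLin := by
    rw [← LinearMap.ker_eq_bot, LinearMap.ker_eq_bot']
    intro v hv
    by_contra hne
    exact hcon ⟨v, hne, (G.pinnedRigidityMatrix_mulVec_eq_zero_iff u w _ v).1 hv⟩
  -- Holds for finite free modules over any nontrivial commutative ring, so the kernel vector has
  -- polynomial entries without clearing denominators.
  have := card_le_of_injective _ _ hinj
  simp only [Fintype.card_prod, Fintype.card_sum, Fintype.card_fin] at this
  omega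

/-- With fewer edges, flowing along a polynomial motion deforms `p` while keeping all edge lengths.
Since the field is tangent to the fibres at every point, no constant rank argument is needed. -/
theorem Realisation.Generic.card_edgeSet {p : Realisation V} (hp : p.Generic) (hr : p.Rigid G)
    {u w : V} (huw : u ≠ w) : 2 * Fintype.card V ≤ Fintype.card G.edgeSet + 3 := by
  by_contra! hcard
  obtain ⟨v, hv0, hv, hu0, hu1, hw0⟩ := G.exists_polynomial_motion u w hcard
  let ev (m : Realisation V) (c : V × Fin 2) : ℝ :=
    MvPolynomial.aeval (fun c : V × Fin 2 => m c.1 c.2) (v c)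
  have hev : ∀ m x y, G.Adj x y → (m x 0 - m y 0) * (ev m (x, 0) - ev m (y, 0)) +
        (m x 1 - m y 1) * (ev m (x, 1) - ev m (y, 1)) = 0 := by
    intro m x y hxy
    have := congrArg (MvPolynomial.aeval (fun c : V × Fin 2 => m c.1 c.2)) (hv x y hxy)
    simpa [ev] using this
  let X (m : Realisation V) : Realisation V := fun x => WithLp.toLp 2 fun i => ev m (x, i)
  have hX : ContDiff ℝ 1 X := by
    rw [contDiff_pi]
    intro x
    rw [contDiff_euclidean]
    intro i
    refine AnalyticOnNhd.contDiff fun m _ => ?_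
    refine AnalyticAt.aeval_mvPolynomial (fun c => ?_) _
    exact (((EuclideanSpace.proj c.2 : EuclideanSpace ℝ (Fin 2) →L[ℝ] ℝ).comp
      (ContinuousLinearMap.proj (R := ℝ) (φ := fun _ : V => EuclideanSpace ℝ (Fin 2)) c.1)).analyticAt m)
  -- The integral curve of the polynomial field starting at `p`.
  obtain ⟨γ, hγ0, δ, hδ, hγ⟩ :=
    (hX.contDiffAt (x := p)).exists_forall_mem_closedBall_exists_eq_forall_mem_Ioo_hasDerivAt₀ 0
  simp only [zero_sub, zero_add] at hγ
  have hd : ∀ t ∈ Set.Ioo (-δ) δ, ∀ x i, HasDerivAt (fun t => γ t x i) (ev (γ t) (x, i)) t := by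
    intro t ht x i
    have h1 := hasDerivAt_pi.1 (hγ t ht) x
    have h2 := (EuclideanSpace.proj i : EuclideanSpace ℝ (Fin 2) →L[ℝ] ℝ).hasFDerivAt.comp_hasDerivAt
      t h1
    exact h2
  have hdist : ∀ t ∈ Set.Ioo (-δ) δ, ∀ x y,
      HasDerivAt (fun t => (γ t x 0 - γ t y 0) ^ 2 + (γ t x 1 - γ t y 1) ^ 2)
        (2 * ((γ t x 0 - γ t y 0) * (ev (γ t) (x, 0) - ev (γ t) (y, 0)) +
        (γ t x 1 - γ t y 1) * (ev (γ t) (x, 1) - ev (γ t) (y, 1)))) t := by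
    intro t ht x y
    refine ((((hd t ht x 0).fun_sub (hd t ht y 0)).fun_pow 2).fun_add
      (((hd t ht x 1).fun_sub (hd t ht y 1)).fun_pow 2)).congr_deriv ?_
    push_cast
    ring
  have h0 : (0 : ℝ) ∈ Set.Ioo (-δ) δ := by simp [hδ]
  have hequiv : ∀ t ∈ Set.Ioo (-δ) δ, Realisation.Equivalent G p (γ t) := by
    intro t ht
    rw [Realisation.equivalent_iff]
    intro x y hxy
    have hconst := (convex_Ioo (-δ) δ).is_const_of_fderivWithin_eq_zero (𝕜 := ℝ)
      (f := fun t => (γ t x 0 - γ t y 0) ^ 2 + (γ t x 1 - γ t y 1) ^ 2)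
      (fun s hs => (hdist s hs x y).differentiableAt.differentiableWithinAt)
      (fun s hs => by
        rw [fderivWithin_of_isOpen isOpen_Ioo hs]
        have := hdist s hs x y
        rw [hev _ _ _ hxy, mul_zero] at this
        simpa using this.hasFDerivAt.fderiv) h0 ht
    simpa only [hγ0] using hconst
  obtain ⟨ε, hε, hrig⟩ := hr
  have hcongr : ∀ᶠ t in nhds (0 : ℝ), Congruent p (γ t) := by
    have hc : Filter.Tendsto γ (nhds 0) (nhds p) := by
      have := (hγ 0 h0).continuousAt
      rwa [ContinuousAt, hγ0] at this
    filter_upwards [isOpen_Ioo.mem_nhds h0, hc (Metric.ball_mem_nhds p hε)] with t ht hball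
    refine hrig _ (hequiv t ht) fun x => ?_
    have := (dist_pi_lt_iff hε).1 (Metric.mem_ball.1 hball) x
    rwa [dist_eq_norm] at this
  -- All pairwise distances are constant near time 0, so the initial velocity preserves them to
  -- first order. Being pinned as well, it vanishes.
  have hzero : ev p = 0 := by
    refine hp.eq_zero_of_pinned huw (by simp [ev, hu0]) (by simp [ev, hu1]) (by simp [ev, hw0])
      fun x y => ?_
    have h1 := hdist 0 h0 x y
    have h2 : HasDerivAt (fun t => (γ t x 0 - γ t y 0) ^ 2 + (γ t x 1 - γ t y 1) ^ 2) 0 0 := by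
      refine (hasDerivAt_const (0 : ℝ) ((p x 0 - p y 0) ^ 2 + (p x 1 - p y 1) ^ 2)).congr_of_eventuallyEq ?_
      filter_upwards [hcongr] with t ht
      rw [Realisation.congruent_iff] at ht
      exact (ht x y).symm
    have h3 := h1.unique h2
    rw [hγ0] at h3
    linarith
  refine hv0 (funext fun c => ?_)
  by_contra hc
  exact hp.aeval_ne_zero hc (congrFun hzero c)

end Flex

/-! ### Three circles through a common point -/

/-- For `(x₂, y₂)` and `(x₃, y₃)` linearly independent, this vanishes if and only if the circles
around `(0, 0)`, `(x₂, y₂)`, `(x₃, y₃)` with squared radii `L₁`, `L₂`, `L₃` have a common point. -/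
noncomputable def circleDefect (L₁ L₂ L₃ x₂ y₂ x₃ y₃ : ℝ) : ℝ :=
  L₁ * (x₂ * y₃ - x₃ * y₂) ^ 2 -
    (((x₂ ^ 2 + y₂ ^ 2 - L₂ + L₁) / 2 * x₃ - (x₃ ^ 2 + y₃ ^ 2 - L₃ + L₁) / 2 * x₂) ^ 2 +
      ((x₂ ^ 2 + y₂ ^ 2 - L₂ + L₁) / 2 * y₃ - (x₃ ^ 2 + y₃ ^ 2 - L₃ + L₁) / 2 * y₂) ^ 2)

lemma exists_cramer_two (k₂ k₃ : ℝ) {x₂ y₂ x₃ y₃ : ℝ} (hΔ : x₂ * y₃ - x₃ * y₂ ≠ 0) :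
    ∃ e f : ℝ, e * x₂ + f * y₂ = k₂ ∧ e * x₃ + f * y₃ = k₃ := by
  have hi := mul_inv_cancel₀ hΔ
  exact ⟨(k₂ * y₃ - k₃ * y₂) * (x₂ * y₃ - x₃ * y₂)⁻¹, (k₃ * x₂ - k₂ * x₃) * (x₂ * y₃ - x₃ * y₂)⁻¹,
    by linear_combination k₂ * hi, by linear_combination k₃ * hi⟩

/-- The radical centre of the three circles. -/
lemma exists_radicalCentre (L₁ L₂ L₃ : ℝ) {x₂ y₂ x₃ y₃ : ℝ} (hΔ : x₂ * y₃ - x₃ * y₂ ≠ 0) :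
    ∃ e f : ℝ, e * x₂ + f * y₂ = (x₂ ^ 2 + y₂ ^ 2 - L₂ + L₁) / 2 ∧
      e * x₃ + f * y₃ = (x₃ ^ 2 + y₃ ^ 2 - L₃ + L₁) / 2 ∧
      (L₁ - (e ^ 2 + f ^ 2)) * (x₂ * y₃ - x₃ * y₂) ^ 2 = circleDefect L₁ L₂ L₃ x₂ y₂ x₃ y₃ := by
  obtain ⟨e, f, h2, h3⟩ := exists_cramer_two ((x₂ ^ 2 + y₂ ^ 2 - L₂ + L₁) / 2)
    ((x₃ ^ 2 + y₃ ^ 2 - L₃ + L₁) / 2) hΔ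
  refine ⟨e, f, h2, h3, ?_⟩
  rw [circleDefect, ← h2, ← h3]
  ring

lemma exists_of_circleDefect_eq_zero {L₁ L₂ L₃ x₂ y₂ x₃ y₃ : ℝ}
    (h : circleDefect L₁ L₂ L₃ x₂ y₂ x₃ y₃ = 0) (hΔ : x₂ * y₃ - x₃ * y₂ ≠ 0) :
    ∃ e f : ℝ, e ^ 2 + f ^ 2 = L₁ ∧ (e - x₂) ^ 2 + (f - y₂) ^ 2 = L₂ ∧
      (e - x₃) ^ 2 + (f - y₃) ^ 2 = L₃ := by
  obtain ⟨e, f, h2, h3, h1⟩ := exists_radicalCentre L₁ L₂ L₃ hΔ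
  rw [h] at h1
  have h1 : L₁ - (e ^ 2 + f ^ 2) = 0 := (mul_eq_zero.1 h1).resolve_right (pow_ne_zero 2 hΔ)
  exact ⟨e, f, by linarith, by linear_combination -2 * h2 - h1, by linear_combination -2 * h3 - h1⟩

lemma circleDefect_eq_zero {L₁ L₂ L₃ x₂ y₂ x₃ y₃ e f : ℝ} (h1 : e ^ 2 + f ^ 2 = L₁)
    (h2 : (e - x₂) ^ 2 + (f - y₂) ^ 2 = L₂) (h3 : (e - x₃) ^ 2 + (f - y₃) ^ 2 = L₃) :
    circleDefect L₁ L₂ L₃ x₂ y₂ x₃ y₃ = 0 := by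
  subst h1 h2 h3
  unfold circleDefect
  ring

/-- For collinear centres only minus a sum of two squares is left. Hence a positive defect
guarantees that the radical centre exists and is unique. -/
lemma circleDefect_nonpos_of_cross_eq_zero {L₁ x₂ y₂ x₃ y₃ : ℝ} (L₂ L₃ : ℝ)
    (hΔ : x₂ * y₃ - x₃ * y₂ = 0) : circleDefect L₁ L₂ L₃ x₂ y₂ x₃ y₃ ≤ 0 := by
  rw [circleDefect, hΔ]
  generalize (x₂ ^ 2 + y₂ ^ 2 - L₂ + L₁) / 2 * x₃ - (x₃ ^ 2 + y₃ ^ 2 - L₃ + L₁) / 2 * x₂ = a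
  generalize (x₂ ^ 2 + y₂ ^ 2 - L₂ + L₁) / 2 * y₃ - (x₃ ^ 2 + y₃ ^ 2 - L₃ + L₁) / 2 * y₂ = b
  linarith [sq_nonneg a, sq_nonneg b]

lemma eq_of_circleDefect_eq_zero_of_cross_eq_zero {L₁ L₂ L₃ x₂ y₂ x₃ y₃ : ℝ}
    (h : circleDefect L₁ L₂ L₃ x₂ y₂ x₃ y₃ = 0) (hΔ : x₂ * y₃ - x₃ * y₂ = 0) :
    (x₂ ^ 2 + y₂ ^ 2 - L₂ + L₁) / 2 * x₃ - (x₃ ^ 2 + y₃ ^ 2 - L₃ + L₁) / 2 * x₂ = 0 := by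
  rw [circleDefect, hΔ] at h
  generalize (x₂ ^ 2 + y₂ ^ 2 - L₂ + L₁) / 2 * x₃ - (x₃ ^ 2 + y₃ ^ 2 - L₃ + L₁) / 2 * x₂ = a at *
  generalize (x₂ ^ 2 + y₂ ^ 2 - L₂ + L₁) / 2 * y₃ - (x₃ ^ 2 + y₃ ^ 2 - L₃ + L₁) / 2 * y₂ = b at *
  exact pow_eq_zero_iff two_ne_zero |>.1
    (le_antisymm (by linarith [sq_nonneg b]) (sq_nonneg a))

/-- The vector $(u,v)$ is the velocity of the radical centre $c$. The defect is
$(L_1-|c|^2)\Delta^2$, whose first factor vanishes at `t`, so only the derivative of $|c|^2$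
contributes. -/
lemma hasDerivAt_circleDefect {x₂ y₂ x₃ y₃ : ℝ → ℝ} {x₂' y₂' x₃' y₃' t : ℝ}
    (hx₂ : HasDerivAt x₂ x₂' t) (hy₂ : HasDerivAt y₂ y₂' t) (hx₃ : HasDerivAt x₃ x₃' t)
    (hy₃ : HasDerivAt y₃ y₃' t) (hΔ : x₂ t * y₃ t - x₃ t * y₂ t ≠ 0) {L₁ L₂ L₃ e f : ℝ}
    (h1 : e ^ 2 + f ^ 2 = L₁) (h2 : (e - x₂ t) ^ 2 + (f - y₂ t) ^ 2 = L₂)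
    (h3 : (e - x₃ t) ^ 2 + (f - y₃ t) ^ 2 = L₃) :
    ∃ u v : ℝ, u * x₂ t + v * y₂ t = (x₂ t - e) * x₂' + (y₂ t - f) * y₂' ∧
      u * x₃ t + v * y₃ t = (x₃ t - e) * x₃' + (y₃ t - f) * y₃' ∧
      HasDerivAt (fun s => circleDefect L₁ L₂ L₃ (x₂ s) (y₂ s) (x₃ s) (y₃ s))
        (-2 * (x₂ t * y₃ t - x₃ t * y₂ t) ^ 2 * (e * u + f * v)) t := by
  obtain ⟨u, v, hu, hv⟩ := exists_cramer_two ((x₂ t - e) * x₂' + (y₂ t - f) * y₂')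
    ((x₃ t - e) * x₃' + (y₃ t - f) * y₃') hΔ
  refine ⟨u, v, hu, hv, ?_⟩
  have hk : ∀ {x y : ℝ → ℝ} {x' y' : ℝ} (L : ℝ), HasDerivAt x x' t → HasDerivAt y y' t →
      HasDerivAt (fun s => (x s ^ 2 + y s ^ 2 - L + L₁) / 2) (x t * x' + y t * y') t := by
    intro x y x' y' L hx hy
    refine ((((hx.fun_pow 2).fun_add (hy.fun_pow 2)).sub_const L).add_const L₁
      |>.div_const 2).congr_deriv ?_
    push_cast
    ring
  have k2 := hk L₂ hx₂ hy₂
  have k3 := hk L₃ hx₃ hy₃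
  have hd := ((((hx₂.fun_mul hy₃).fun_sub (hx₃.fun_mul hy₂)).fun_pow 2).const_mul L₁).fun_sub
    ((((k2.fun_mul hx₃).fun_sub (k3.fun_mul hx₂)).fun_pow 2).fun_add
      (((k2.fun_mul hy₃).fun_sub (k3.fun_mul hy₂)).fun_pow 2))
  refine hd.congr_deriv ?_
  have e2 : (x₂ t ^ 2 + y₂ t ^ 2 - L₂ + L₁) / 2 = e * x₂ t + f * y₂ t := by
    linear_combination h2 / 2 - h1 / 2
  have e3 : (x₃ t ^ 2 + y₃ t ^ 2 - L₃ + L₁) / 2 = e * x₃ t + f * y₃ t := by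
    linear_combination h3 / 2 - h1 / 2
  have d2 : x₂ t * x₂' + y₂ t * y₂' = u * x₂ t + v * y₂ t + e * x₂' + f * y₂' := by
    linear_combination -hu
  have d3 : x₃ t * x₃' + y₃ t * y₃' = u * x₃ t + v * y₃ t + e * x₃' + f * y₃' := by
    linear_combination -hv
  rw [e2, e3, d2, d3, ← h1]
  push_cast
  ring

/-! ### Sign changes -/

lemma exists_mul_neg_of_hasDerivAt {f : ℝ → ℝ} {f' c : ℝ} (hf : HasDerivAt f f' c) (hc : f c = 0)
    (hf' : f' ≠ 0) {a b : ℝ} (hac : a < c) (hcb : c < b) :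
    ∃ l ∈ Set.Ioo a c, ∃ r ∈ Set.Ioo c b, f l * f r < 0 := by
  have hslope : ∀ᶠ t in nhdsWithin c {c}ᶜ, 0 < slope f c t * f' := by
    have := (hasDerivAt_iff_tendsto_slope.1 hf).mul_const f'
    exact this.eventually (lt_mem_nhds (mul_self_pos.2 hf'))
  have hl : ∀ᶠ t in nhdsWithin c (Set.Iio c), 0 < slope f c t * f' :=
    hslope.filter_mono (nhdsWithin_mono _ fun t ht => ne_of_lt ht)
  have hr : ∀ᶠ t in nhdsWithin c (Set.Ioi c), 0 < slope f c t * f' :=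
    hslope.filter_mono (nhdsWithin_mono _ fun t ht => ne_of_gt ht)
  obtain ⟨l, hl1, hl2⟩ := (hl.and (Ioo_mem_nhdsLT hac)).exists
  obtain ⟨r, hr1, hr2⟩ := (hr.and (Ioo_mem_nhdsGT hcb)).exists
  refine ⟨l, hl2, r, hr2, ?_⟩
  rw [slope_def_field, hc, sub_zero] at hl1 hr1
  have hpos : 0 < (f l * f r) * (f' ^ 2 / ((l - c) * (r - c))) := by
    have := mul_pos hl1 hr1
    have h1 : l - c ≠ 0 := (sub_neg.2 hl2.2).ne
    have h2 : r - c ≠ 0 := (sub_pos.2 hr2.1).ne'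
    have e : f l * f r * (f' ^ 2 / ((l - c) * (r - c))) =
        f l / (l - c) * f' * (f r / (r - c) * f') := by
      field_simp
    rwa [e]
  have hneg : f' ^ 2 / ((l - c) * (r - c)) < 0 :=
    div_neg_of_pos_of_neg (by positivity)
      (mul_neg_of_neg_of_pos (sub_neg.2 hl2.2) (sub_pos.2 hr2.1))
  exact neg_of_mul_pos_left hpos hneg.le

lemma mul_pos_of_forall_ne_zero {f : ℝ → ℝ} {a b : ℝ} (hab : a ≤ b)
    (hf : ContinuousOn f (Set.Icc a b)) (h0 : ∀ t ∈ Set.Icc a b, f t ≠ 0) : 0 < f a * f b := by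
  by_contra! hle
  have ha := h0 a (Set.left_mem_Icc.2 hab)
  have hb := h0 b (Set.right_mem_Icc.2 hab)
  rcases lt_or_gt_of_ne ha with ha' | ha'
  · have hb' : 0 < f b := lt_of_le_of_ne (by nlinarith) hb.symm
    obtain ⟨t, ht, h⟩ := intermediate_value_Icc hab hf ⟨ha'.le, hb'.le⟩
    exact h0 t ht h
  · have hb' : f b < 0 := lt_of_le_of_ne (by nlinarith) hb
    obtain ⟨t, ht, h⟩ := intermediate_value_Icc' hab hf ⟨hb'.le, ha'.le⟩
    exact h0 t ht h

/-- A continuous function with a single, simple zero changes sign. -/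
lemma mul_neg_of_unique_zero {f : ℝ → ℝ} {f' a b c : ℝ} (hf : ContinuousOn f (Set.Icc a b))
    (hac : a < c) (hcb : c < b) (hc : f c = 0) (hd : HasDerivAt f f' c) (hf' : f' ≠ 0)
    (h0 : ∀ t ∈ Set.Icc a b, t ≠ c → f t ≠ 0) : f a * f b < 0 := by
  obtain ⟨l, hl, r, hr, hlr⟩ := exists_mul_neg_of_hasDerivAt hd hc hf' hac hcb
  have h1 : 0 < f a * f l := mul_pos_of_forall_ne_zero hl.1.le
    (hf.mono (Set.Icc_subset_Icc_right (hl.2.trans hcb).le))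
    fun t ht => h0 t ⟨ht.1, ht.2.trans (hl.2.trans hcb).le⟩ (ht.2.trans_lt hl.2).ne
  have h2 : 0 < f r * f b := mul_pos_of_forall_ne_zero hr.2.le
    (hf.mono (Set.Icc_subset_Icc_left (hac.trans hr.1).le))
    fun t ht => h0 t ⟨(hac.trans hr.1).le.trans ht.1, ht.2⟩ (hr.1.trans_le ht.1).ne'
  have h3 : (f l * f r) * (f a * f b) = (f a * f l) * (f r * f b) := by ring
  exact neg_of_mul_pos_right (h3 ▸ mul_pos h1 h2) hlr.le

/-- Taking the first zero, rather than any zero, makes it a limit of points where `f` is positive.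
-/
lemma exists_first_zero {f : ℝ → ℝ} {a b : ℝ} (hab : a ≤ b) (hf : ContinuousOn f (Set.Icc a b))
    (ha : 0 < f a) (hb : f b ≤ 0) :
    ∃ c ∈ Set.Ioc a b, f c = 0 ∧ ∀ t ∈ Set.Ico a c, 0 < f t := by
  have hK : IsCompact (Set.Icc a b ∩ f ⁻¹' Set.Iic 0) :=
    isCompact_Icc.of_isClosed_subset (hf.preimage_isClosed_of_isClosed isClosed_Icc isClosed_Iic)
      Set.inter_subset_left
  obtain ⟨c, ⟨hc, hfc⟩, hmin⟩ := hK.exists_isLeast ⟨b, Set.right_mem_Icc.2 hab, hb⟩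
  have hpos : ∀ t ∈ Set.Ico a c, 0 < f t := fun t ht => by
    by_contra! h
    exact absurd (hmin ⟨⟨ht.1, ht.2.le.trans hc.2⟩, h⟩) (not_le.2 ht.2)
  have hac : a < c := lt_of_le_of_ne hc.1 fun h => absurd hfc (by simpa [← h] using ha)
  refine ⟨c, ⟨hac, hc.2⟩, le_antisymm hfc ?_, hpos⟩
  have hcl : c ∈ closure (Set.Ico a c) := by
    rw [closure_Ico hac.ne]
    exact Set.right_mem_Icc.2 hac.le
  have hcont : ContinuousWithinAt f (Set.Ico a c) c :=
    (hf c hc).mono fun t ht => ⟨ht.1, ht.2.le.trans hc.2⟩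
  exact continuousWithinAt_const.closure_le hcl hcont fun t ht => (hpos t ht).le

/-! ### Realisations of `K₃,₃`

One side of the bipartition consists of the points `(x i, y i)`, the other one of
`(0, 0)`, `(1, 0)` and `(g, h)`. We move the second of these three points to `(s, 0)`. -/

namespace BipartiteLinkage

/-- First coordinate of a point at the original distances from `(0, 0)` and `(s, 0)`. -/
noncomputable def posX (x : Fin 3 → ℝ) (s : ℝ) (i : Fin 3) : ℝ := (2 * x i - 1 + s ^ 2) / (2 * s)

/-- Sixteen times the squared area of the triangle spanned by that point, `(0, 0)`, `(s, 0)`. -/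
def areaSq (x y : Fin 3 → ℝ) (s : ℝ) (i : Fin 3) : ℝ :=
  4 * s ^ 2 * (x i ^ 2 + y i ^ 2) - (2 * x i - 1 + s ^ 2) ^ 2

/-- Second coordinate of that point, on the side prescribed by the sign `ε i`. -/
noncomputable def posY (x y : Fin 3 → ℝ) (ε : Fin 3 → ℝ) (s : ℝ) (i : Fin 3) : ℝ :=
  ε i * (Real.sqrt (areaSq x y s i) / (2 * s))

/-- The obstruction to placing the point `(g, h)`. -/
noncomputable def defect (x y : Fin 3 → ℝ) (g h : ℝ) (ε : Fin 3 → ℝ) (s : ℝ) : ℝ :=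
  circleDefect ((x 0 - g) ^ 2 + (y 0 - h) ^ 2) ((x 1 - g) ^ 2 + (y 1 - h) ^ 2)
    ((x 2 - g) ^ 2 + (y 2 - h) ^ 2)
    (posX x s 1 - posX x s 0) (posY x y ε s 1 - posY x y ε s 0)
    (posX x s 2 - posX x s 0) (posY x y ε s 2 - posY x y ε s 0)

variable {x y : Fin 3 → ℝ} {g h : ℝ} {ε : Fin 3 → ℝ} {s : ℝ}

lemma posX_sq_add_posY_sq (hε : ∀ i, ε i ^ 2 = 1) (hs : 0 < s) {i : Fin 3}
    (hA : 0 ≤ areaSq x y s i) : posX x s i ^ 2 + posY x y ε s i ^ 2 = x i ^ 2 + y i ^ 2 := by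
  rw [posX, posY, mul_pow, hε, div_pow, div_pow, Real.sq_sqrt hA, areaSq]
  field_simp
  ring

lemma posX_sub_sq_add_posY_sq (hε : ∀ i, ε i ^ 2 = 1) (hs : 0 < s) {i : Fin 3}
    (hA : 0 ≤ areaSq x y s i) :
    (posX x s i - s) ^ 2 + posY x y ε s i ^ 2 = (x i - 1) ^ 2 + y i ^ 2 := by
  have h1 := posX_sq_add_posY_sq hε hs hA
  have h2 : 2 * s * posX x s i = 2 * x i - 1 + s ^ 2 := by
    rw [posX]
    field_simp
  linear_combination h1 - h2

/-- The points on the first side cannot become collinear. -/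
lemma exists_of_defect_eq_zero (hh : h ≠ 0)
    (hΔ : (x 1 - x 0) * (y 2 - y 0) - (x 2 - x 0) * (y 1 - y 0) ≠ 0)
    (hε : ∀ i, ε i ^ 2 = 1) (hs : 0 < s) (hA : ∀ i, 0 ≤ areaSq x y s i)
    (h0 : defect x y g h ε s = 0) :
    ∃ g' h' : ℝ, ∀ i, (posX x s i - g') ^ 2 + (posY x y ε s i - h') ^ 2 =
      (x i - g) ^ 2 + (y i - h) ^ 2 := by
  have hX : ∀ i, s * (posX x s i - posX x s 0) = x i - x 0 := fun i => by
    rw [posX, posX]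
    field_simp
    ring
  have hP := fun i => posX_sq_add_posY_sq hε hs (hA i)
  by_cases hΔ' : (posX x s 1 - posX x s 0) * (posY x y ε s 2 - posY x y ε s 0) -
      (posX x s 2 - posX x s 0) * (posY x y ε s 1 - posY x y ε s 0) = 0
  -- If the centres were collinear, a vanishing defect would also make a second determinant vanish.
  -- Since $s(X_i-X_0)=x_i-x_0$, together these give $h\Delta=0$ for the original cross product
  -- $\Delta$.
  · exfalso
    have hN := eq_of_circleDefect_eq_zero_of_cross_eq_zero h0 hΔ'
    clear h0
    generalize posX x s = X at *
    generalize posY x y ε s = Y at *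
    have hm : ((x 1 - x 0) * g + (y 1 - y 0) * h) * (X 2 - X 0) -
        ((x 2 - x 0) * g + (y 2 - y 0) * h) * (X 1 - X 0) = 0 := by
      linear_combination hN - Y 0 * hΔ' - (X 2 - X 0) / 2 * (hP 1 - hP 0) +
        (X 1 - X 0) / 2 * (hP 2 - hP 0)
    refine mul_ne_zero hh hΔ ?_
    linear_combination -s * hm + ((x 1 - x 0) * g + (y 1 - y 0) * h) * hX 2 -
      ((x 2 - x 0) * g + (y 2 - y 0) * h) * hX 1
  · obtain ⟨e, f, h1, h2, h3⟩ := exists_of_circleDefect_eq_zero h0 hΔ'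
    refine ⟨posX x s 0 + e, posY x y ε s 0 + f, fun i => ?_⟩
    fin_cases i
    · simp only [Fin.zero_eta]
      linear_combination h1
    · simp only [Fin.mk_one]
      linear_combination h2
    · simp only [Fin.reduceFinMk]
      linear_combination h3

lemma continuousOn_defect : ContinuousOn (defect x y g h ε) (Set.Ioi 0) := by
  have hX : ∀ i, ContinuousOn (fun s => posX x s i) (Set.Ioi 0) := fun i =>
    ContinuousOn.div (by fun_prop) (by fun_prop) fun s hs => by simpa using (ne_of_gt hs)
  have hY : ∀ i, ContinuousOn (fun s => posY x y ε s i) (Set.Ioi 0) := fun i =>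
    continuousOn_const.mul (ContinuousOn.div (by unfold areaSq; fun_prop) (by fun_prop)
      fun s hs => by simpa using (ne_of_gt hs))
  unfold defect circleDefect
  have := hX 0
  have := hX 1
  have := hX 2
  have := hY 0
  have := hY 1
  have := hY 2
  fun_prop

/-- When a point crosses the line through `(0, 0)` and `(s, 0)`, it may change sides. -/
lemma defect_update {i : Fin 3} (hA : areaSq x y s i = 0) (c : ℝ) :
    defect x y g h (Function.update ε i c) s = defect x y g h ε s := by
  have : posY x y (Function.update ε i c) s = posY x y ε s := by
    funext j
    by_cases hj : j = i
    · subst hj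
      simp [posY, hA]
    · simp [posY, Function.update_of_ne hj]
  rw [defect, this, defect]

lemma areaSq_one (x y : Fin 3 → ℝ) (i : Fin 3) : areaSq x y 1 i = 4 * y i ^ 2 := by
  rw [areaSq]
  ring

lemma sqrt_areaSq_one (x y : Fin 3 → ℝ) (i : Fin 3) : Real.sqrt (areaSq x y 1 i) = 2 * |y i| := by
  rw [areaSq_one, show 4 * y i ^ 2 = (2 * y i) ^ 2 by ring, Real.sqrt_sq_eq_abs, abs_mul, abs_two]

lemma posX_one (x : Fin 3 → ℝ) (i : Fin 3) : posX x 1 i = x i := by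
  rw [posX]
  ring

lemma posY_one (x y : Fin 3 → ℝ) (ε : Fin 3 → ℝ) (i : Fin 3) : posY x y ε 1 i = ε i * |y i| := by
  rw [posY, sqrt_areaSq_one]
  ring

lemma hasDerivAt_posX (x : Fin 3 → ℝ) (i : Fin 3) :
    HasDerivAt (fun s => posX x s i) (1 - x i) 1 := by
  unfold posX
  refine ((((hasDerivAt_id' (1 : ℝ)).fun_pow 2).const_add (2 * x i - 1)).fun_div
    ((hasDerivAt_id' (1 : ℝ)).const_mul 2) (by norm_num)).congr_deriv ?_
  norm_num
  ring

lemma hasDerivAt_posY {i : Fin 3} (hy : y i ≠ 0) (hεi : ε i * |y i| = y i) :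
    HasDerivAt (fun s => posY x y ε s i) ((x i ^ 2 - x i) / y i) 1 := by
  have hA : HasDerivAt (fun s => areaSq x y s i) (8 * (x i ^ 2 + y i ^ 2) - 8 * x i) 1 := by
    unfold areaSq
    have h1 := (hasDerivAt_id' (1 : ℝ)).fun_pow 2
    refine (((h1.const_mul 4).mul_const (x i ^ 2 + y i ^ 2)).fun_sub
      ((h1.const_add (2 * x i - 1)).fun_pow 2)).congr_deriv ?_
    norm_num
    ring
  have hA0 : areaSq x y 1 i ≠ 0 := by
    rw [areaSq_one]
    positivity
  have habs : |y i| ≠ 0 := abs_ne_zero.2 hy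
  refine (((hA.sqrt hA0).fun_div ((hasDerivAt_id' (1 : ℝ)).const_mul 2)
    (by norm_num)).const_mul (ε i)).congr_deriv ?_
  rw [sqrt_areaSq_one]
  have hεi' : ε i = y i / |y i| := by rw [eq_div_iff habs, hεi]
  rw [hεi']
  have hsq : |y i| ^ 2 = y i ^ 2 := sq_abs _
  field_simp
  rw [hsq]
  ring

end BipartiteLinkage

/-! ### The second realisation of $K_{3,3}$ -/

namespace BipartiteLinkage

variable {x y : Fin 3 → ℝ} {g h : ℝ}

/-- If the realisation has no infinitesimal motion changing the distance from `(0, 0)` to `(1, 0)`,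
then the defect has a simple zero. -/
lemma exists_hasDerivAt_defect (hy : ∀ i, y i ≠ 0)
    (hΔ : (x 1 - x 0) * (y 2 - y 0) - (x 2 - x 0) * (y 1 - y 0) ≠ 0)
    (hrig : ∀ (a b : Fin 3 → ℝ) (c d : ℝ), (∀ i, x i * a i + y i * b i = 0) →
      (∀ i, (x i - 1) * (a i - 1) + y i * b i = 0) →
      (∀ i, (x i - g) * (a i - c) + (y i - h) * (b i - d) = 0) → False)
    {ε : Fin 3 → ℝ} (hε : ∀ i, ε i * |y i| = y i) :
    ∃ D ≠ 0, HasDerivAt (defect x y g h ε) D 1 := by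
  have hX := hasDerivAt_posX x
  have hY := fun i => hasDerivAt_posY (x := x) (hy i) (hε i)
  have hX1 := posX_one x
  have hY1 : ∀ i, posY x y ε 1 i = y i := fun i => by rw [posY_one, hε]
  obtain ⟨u, v, hu, hv, hd⟩ := hasDerivAt_circleDefect ((hX 1).fun_sub (hX 0))
    ((hY 1).fun_sub (hY 0)) ((hX 2).fun_sub (hX 0)) ((hY 2).fun_sub (hY 0))
    (by simpa only [hX1, hY1] using hΔ)
    (L₁ := (x 0 - g) ^ 2 + (y 0 - h) ^ 2) (L₂ := (x 1 - g) ^ 2 + (y 1 - h) ^ 2)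
    (L₃ := (x 2 - g) ^ 2 + (y 2 - h) ^ 2) (e := g - x 0) (f := h - y 0)
    (by ring) (by simp only [hX1, hY1]; ring) (by simp only [hX1, hY1]; ring)
  refine ⟨_, ?_, hd⟩
  simp only [hX1, hY1] at hu hv ⊢
  refine mul_ne_zero (mul_ne_zero (by norm_num) (pow_ne_zero 2 hΔ)) fun he => ?_
  -- A vanishing derivative yields a forbidden motion: the derivatives of `posX` and `posY` at
  -- $s=1$, and for $(g,h)$ the velocity of point 0 plus that of the radical centre relative to it.
  refine hrig (fun i => 1 - x i) (fun i => (x i ^ 2 - x i) / y i) (1 - x 0 + u)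
    ((x 0 ^ 2 - x 0) / y 0 + v) (fun i => ?_) (fun i => ?_) (fun i => ?_)
  · have := hy i
    field_simp
    ring
  · have := hy i
    field_simp
    ring
  · fin_cases i
    · simp only [Fin.zero_eta]
      linear_combination he
    · simp only [Fin.mk_one]
      linear_combination he - hu
    · simp only [Fin.reduceFinMk]
      linear_combination he - hv

lemma continuous_areaSq (x y : Fin 3 → ℝ) (i : Fin 3) : Continuous fun s => areaSq x y s i := by
  unfold areaSq
  fun_prop

/-- The interval of possible distances from `(0, 0)` to `(s, 0)`. -/
lemma exists_extremal_lengths (hy : ∀ i, y i ≠ 0)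
    (hΔ : (x 1 - x 0) * (y 2 - y 0) - (x 2 - x 0) * (y 1 - y 0) ≠ 0) :
    ∃ a b : ℝ, 0 < a ∧ a < 1 ∧ 1 < b ∧ (∀ s ∈ Set.Icc a b, ∀ i, 0 ≤ areaSq x y s i) ∧
      (∃ i, areaSq x y a i = 0) ∧ ∃ i, areaSq x y b i = 0 := by
  set A : ℝ → ℝ := fun s => Finset.univ.inf' Finset.univ_nonempty (areaSq x y s) with hA
  have hAc : Continuous A :=
    Continuous.finset_inf'_apply _ fun i _ => continuous_areaSq x y i
  have hAle : ∀ s i, A s ≤ areaSq x y s i := fun s i => Finset.inf'_le _ (Finset.mem_univ i)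
  have hAex : ∀ s, ∃ i, areaSq x y s i = A s := fun s => by
    obtain ⟨i, -, hi⟩ := Finset.exists_mem_eq_inf' (Finset.univ_nonempty (α := Fin 3))
      (areaSq x y s)
    exact ⟨i, hi.symm⟩
  have hA1 : 0 < A 1 := by
    obtain ⟨i, hi⟩ := hAex 1
    rw [← hi, areaSq_one]
    have := hy i
    positivity
  have hA0 : A 0 < 0 := by
    -- If every `x i` were $1/2$, the three points would be collinear.
    obtain ⟨i, hi⟩ : ∃ i, 2 * x i - 1 ≠ 0 := by
      by_contra! hall
      apply hΔ
      linear_combination (hall 1 - hall 0) / 2 * (y 2 - y 0) - (hall 2 - hall 0) / 2 * (y 1 - y 0)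
    refine (hAle 0 i).trans_lt ?_
    rw [areaSq]
    have : 0 < (2 * x i - 1) ^ 2 := by positivity
    linarith
  obtain ⟨S, hS1, hS⟩ : ∃ S : ℝ, 1 ≤ S ∧ A S ≤ 0 := by
    have hP : 0 ≤ x 0 ^ 2 + y 0 ^ 2 := by positivity
    -- With $P=x_0^2+y_0^2$, this $S$ satisfies $2x_0-1+S^2\ge S(2P+1)$, and $(2P+1)^2\ge 4P$ makes
    -- the area expression nonpositive.
    refine ⟨2 + 2 * (x 0 ^ 2 + y 0 ^ 2) + 2 * |x 0|, by linarith [abs_nonneg (x 0)],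
      (hAle _ 0).trans ?_⟩
    rw [areaSq]
    set P := x 0 ^ 2 + y 0 ^ 2
    set S := 2 + 2 * P + 2 * |x 0| with hSdef
    have h1 := abs_nonneg (x 0)
    have h2 := neg_abs_le (x 0)
    have h3 : S * S = S * (2 * P + 1) + S + 2 * (S * |x 0|) := by rw [hSdef]; ring
    have hS1 : 1 ≤ S := by linarith
    have h6 : 1 * |x 0| ≤ S * |x 0| := mul_le_mul_of_nonneg_right hS1 h1
    have h4 : S * (2 * P + 1) ≤ 2 * x 0 - 1 + S ^ 2 := by linarith [sq S]
    have h5 : (S * (2 * P + 1)) ^ 2 ≤ (2 * x 0 - 1 + S ^ 2) ^ 2 :=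
      pow_le_pow_left₀ (by positivity) h4 2
    nlinarith [sq_nonneg (S * (2 * P - 1))]
  obtain ⟨b, hb, hb0, hbpos⟩ := exists_first_zero hS1 hAc.continuousOn hA1 hS
  -- Time is reversed to find the last zero before 1.
  obtain ⟨a, ha, ha0, hapos⟩ := exists_first_zero (f := fun t => A (-t)) (a := -1) (b := 0)
    (by norm_num) (hAc.comp continuous_neg).continuousOn (by simpa using hA1)
    (by simpa using hA0.le)
  have ha_ne : a ≠ 0 := by
    rintro rfl
    simp only [neg_zero] at ha0
    exact hA0.ne ha0
  refine ⟨-a, b, neg_pos.2 (lt_of_le_of_ne ha.2 ha_ne), by linarith [ha.1], hb.1,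
    fun s hs i => le_trans ?_ (hAle s i), ?_, ?_⟩
  · rcases le_total 1 s with h1 | h1
    · rcases hs.2.eq_or_lt with rfl | hlt
      · exact hb0.ge
      · exact (hbpos s ⟨h1, hlt⟩).le
    · rcases hs.1.eq_or_lt with rfl | hlt
      · exact ha0.ge
      · simpa using (hapos (-s) ⟨by linarith, by linarith⟩).le
  · obtain ⟨i, hi⟩ := hAex (-a)
    exact ⟨i, hi.trans ha0⟩
  · obtain ⟨i, hi⟩ := hAex b
    exact ⟨i, hi.trans hb0⟩

/-- The configurations of the linkage form a circle on which the defect changes sign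
an even number of times. -/
theorem exists_other_realisation (hy : ∀ i, y i ≠ 0) (hh : h ≠ 0)
    (hΔ : (x 1 - x 0) * (y 2 - y 0) - (x 2 - x 0) * (y 1 - y 0) ≠ 0)
    (hrig : ∀ (a b : Fin 3 → ℝ) (c d : ℝ), (∀ i, x i * a i + y i * b i = 0) →
      (∀ i, (x i - 1) * (a i - 1) + y i * b i = 0) →
      (∀ i, (x i - g) * (a i - c) + (y i - h) * (b i - d) = 0) → False) :
    ∃ (s g' h' : ℝ) (X Y : Fin 3 → ℝ), 0 < s ∧ (∀ i, X i ^ 2 + Y i ^ 2 = x i ^ 2 + y i ^ 2) ∧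
      (∀ i, (X i - s) ^ 2 + Y i ^ 2 = (x i - 1) ^ 2 + y i ^ 2) ∧
      (∀ i, (X i - g') ^ 2 + (Y i - h') ^ 2 = (x i - g) ^ 2 + (y i - h) ^ 2) ∧
      ¬ (s = 1 ∧ ∀ i j, (X i - X j) ^ 2 + (Y i - Y j) ^ 2 =
        (x i - x j) ^ 2 + (y i - y j) ^ 2) := by
  by_contra hcon
  obtain ⟨a, b, ha0, ha1, h1b, hA, ⟨i₀, hi₀⟩, i₁, hi₁⟩ := exists_extremal_lengths hy hΔ
  have hab : a ≤ b := (ha1.trans h1b).le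
  have hcont : ∀ ε, ContinuousOn (defect x y g h ε) (Set.Icc a b) := fun ε =>
    continuousOn_defect.mono fun s hs => ha0.trans_le hs.1
  -- If there is no other realisation, a zero on any branch is the original one up to congruence:
  -- $s=1$ and the signs are those of `y` up to a global sign.
  have hunique : ∀ ε : Fin 3 → ℝ, (∀ i, ε i ^ 2 = 1) → ∀ s ∈ Set.Icc a b,
      defect x y g h ε s = 0 → s = 1 ∧ ∀ i j, ε i * ε j * (|y i| * |y j|) = y i * y j := by
    intro ε hε s hs h0
    have hs0 := ha0.trans_le hs.1
    obtain ⟨g', h', hgh⟩ := exists_of_defect_eq_zero hh hΔ hε hs0 (hA s hs) h0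
    have hP := fun i => posX_sq_add_posY_sq hε hs0 (hA s hs i)
    have hQ := fun i => posX_sub_sq_add_posY_sq hε hs0 (hA s hs i)
    obtain ⟨rfl, hc⟩ : s = 1 ∧ ∀ i j,
        (posX x s i - posX x s j) ^ 2 + (posY x y ε s i - posY x y ε s j) ^ 2 =
          (x i - x j) ^ 2 + (y i - y j) ^ 2 := by
      by_contra hne
      exact hcon ⟨s, g', h', posX x s, posY x y ε s, hs0, hP, hQ, hgh, hne⟩
    refine ⟨rfl, fun i j => ?_⟩
    have h1 := hc i j
    have h2 := hP i
    have h3 := hP j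
    simp only [posX_one, posY_one] at h1 h2 h3
    linear_combination (h2 + h3 - h1) / 2
  obtain ⟨ε, hε, hεy⟩ : ∃ ε : Fin 3 → ℝ, (∀ i, ε i ^ 2 = 1) ∧ ∀ i, ε i * |y i| = y i := by
    refine ⟨fun i => y i / |y i|, fun i => ?_, fun i => ?_⟩
    · rw [div_pow, sq_abs, div_self (pow_ne_zero 2 (hy i))]
    · exact div_mul_cancel₀ _ (abs_ne_zero.2 (hy i))
  -- Sign choices other than $\pm\varepsilon$ give branches without zeros.
  have hflip : ∀ ε' : Fin 3 → ℝ, (∀ i, ε' i ^ 2 = 1) → (∃ i j, ε' i = -ε i ∧ ε' j = ε j) →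
      0 < defect x y g h ε' a * defect x y g h ε' b := by
    rintro ε' hε' ⟨i, j, hi, hj⟩
    refine mul_pos_of_forall_ne_zero hab (hcont ε') fun s hs h0 => ?_
    have := (hunique ε' hε' s hs h0).2 i j
    rw [hi, hj] at this
    refine mul_ne_zero (hy i) (hy j) ?_
    linear_combination -(1 / 2 : ℝ) * this - (1 / 2 : ℝ) * ε j * |y j| * hεy i -
      (1 / 2 : ℝ) * y i * hεy j
  have hneg : defect x y g h ε a * defect x y g h ε b < 0 := by
    obtain ⟨D, hD, hd⟩ := exists_hasDerivAt_defect hy hΔ hrig hεy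
    refine mul_neg_of_unique_zero (hcont ε) ha1 h1b ?_ hd hD
      fun s hs hne h0 => hne (hunique ε hε s hs h0).1
    simp only [defect, posX_one, posY_one, hεy]
    exact circleDefect_eq_zero (e := g - x 0) (f := h - y 0) (by ring) (by ring) (by ring)
  have hsq : ∀ (ε' : Fin 3 → ℝ) (i : Fin 3), (∀ j, ε' j ^ 2 = 1) →
      ∀ j, Function.update ε' i (-ε i) j ^ 2 = 1 := by
    intro ε' i hε' j
    by_cases hj : j = i
    · subst hj
      simp [hε]
    · simp [Function.update_of_ne hj, hε']
  have hthird : ∀ i k : Fin 3, ∃ l, l ≠ i ∧ l ≠ k := by decide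
  -- If the same triangle degenerates at both ends, the branch of ε and its flip share their end
  -- values, one with a sign change and the other without.
  by_cases hi : i₀ = i₁
  · subst hi
    obtain ⟨l, hl, -⟩ := hthird i₀ i₀
    have := hflip (Function.update ε i₀ (-ε i₀)) (hsq ε i₀ hε)
      ⟨i₀, l, by simp, by simp [Function.update_of_ne hl]⟩
    rw [defect_update hi₀, defect_update hi₁] at this
    exact lt_asymm this hneg
  -- Flipping `i₀` and `i₁` gives four branches glued at their ends into a circle. Only the branch
  -- of ε changes sign, but the total number of sign changes must be even.
  · obtain ⟨l, hl₀, hl₁⟩ := hthird i₀ i₁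
    have h1 := hflip (Function.update ε i₁ (-ε i₁)) (hsq ε i₁ hε)
      ⟨i₁, l, by simp, by simp [Function.update_of_ne hl₁]⟩
    have h2 := hflip (Function.update ε i₀ (-ε i₀)) (hsq ε i₀ hε)
      ⟨i₀, l, by simp, by simp [Function.update_of_ne hl₀]⟩
    have h3 := hflip (Function.update (Function.update ε i₁ (-ε i₁)) i₀ (-ε i₀))
      (hsq _ i₀ (hsq ε i₁ hε))
      ⟨i₀, l, by simp, by simp [Function.update_of_ne hl₀, Function.update_of_ne hl₁]⟩
    rw [defect_update hi₀, Function.update_comm (Ne.symm hi), defect_update hi₁] at h3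
    rw [defect_update hi₁] at h1
    rw [defect_update hi₀] at h2
    have := mul_pos (mul_pos h1 h2) h3
    refine absurd hneg (not_lt.2 (le_of_lt ?_))
    refine pos_of_mul_pos_left (b := (defect x y g h (Function.update ε i₁ (-ε i₁)) a *
      defect x y g h (Function.update ε i₀ (-ε i₀)) b) ^ 2) ?_ (sq_nonneg _)
    linarith

end BipartiteLinkage

/-! ### The second realisation of the prism -/

/-- A periodic function with a simple zero has another zero, which is a limit of points
where the function is positive. -/
lemma Function.Periodic.exists_zero_mem_closure_pos {f : ℝ → ℝ} {T D : ℝ} (hT : 0 < T)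
    (hper : Function.Periodic f T) (hf : Continuous f) (h0 : f 0 = 0) (hd : HasDerivAt f D 0)
    (hD : D ≠ 0) : ∃ t ∈ Set.Ioo 0 T, f t = 0 ∧ t ∈ closure {t | 0 < f t} := by
  obtain ⟨l, hl, r, hr, hlr⟩ := exists_mul_neg_of_hasDerivAt hd h0 hD
    (neg_lt_zero.2 (half_pos hT)) (half_pos hT)
  have hlT : f (l + T) = f l := hper l
  have hle : r ≤ l + T := by linarith [hl.1, hr.2]
  rcases lt_or_ge 0 (f r) with hpos | hnonpos
  · have hneg : f (l + T) < 0 := by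
      rw [hlT]
      exact neg_of_mul_neg_left hlr hpos.le
    obtain ⟨c, hc, hc0, hcpos⟩ := exists_first_zero hle hf.continuousOn hpos hneg.le
    refine ⟨c, ⟨hr.1.trans hc.1, by linarith [hc.2, hl.2]⟩, hc0, ?_⟩
    have : c ∈ closure (Set.Ico r c) := by
      rw [closure_Ico hc.1.ne]
      exact Set.right_mem_Icc.2 hc.1.le
    exact closure_mono hcpos this
  · have hpos : 0 < f (l + T) := by
      rw [hlT]
      exact pos_of_mul_neg_left hlr hnonpos
    obtain ⟨c, hc, hc0, hcpos⟩ := exists_first_zero (f := fun t => f (-t)) (neg_le_neg hle)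
      (hf.comp continuous_neg).continuousOn (by simpa using hpos) (by simpa using hnonpos)
    refine ⟨-c, ⟨by linarith [hc.2, hr.1], by linarith [hc.1, hl.2]⟩, hc0, ?_⟩
    have : -c ∈ closure (Set.Ioc (-c) (l + T)) := by
      have hlt : -c < l + T := by linarith [hc.1]
      rw [closure_Ioc hlt.ne]
      exact Set.left_mem_Icc.2 hlt.le
    refine closure_mono (fun t ht => ?_) this
    have := hcpos (-t) ⟨by linarith [ht.2], by linarith [ht.1]⟩
    simpa using this

/-- Moving along the common normal of two parallel vectors reaches a given distance. -/
lemma exists_of_cross_eq_zero {L x₂ y₂ x₃ y₃ k₂ k₃ e f : ℝ} (hΔ : x₂ * y₃ - x₃ * y₂ = 0)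
    (hL : e ^ 2 + f ^ 2 ≤ L) (h2 : e * x₂ + f * y₂ = k₂) (h3 : e * x₃ + f * y₃ = k₃) :
    ∃ e' f' : ℝ, e' ^ 2 + f' ^ 2 = L ∧ e' * x₂ + f' * y₂ = k₂ ∧ e' * x₃ + f' * y₃ = k₃ := by
  obtain ⟨m, n, hmn, hm2, hm3⟩ : ∃ m n : ℝ, 0 < m ^ 2 + n ^ 2 ∧ m * x₂ + n * y₂ = 0 ∧
      m * x₃ + n * y₃ = 0 := by
    have key : ∀ {a b : ℝ}, ¬ (a = 0 ∧ b = 0) → 0 < (-b) ^ 2 + a ^ 2 := by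
      intro a b hab
      by_cases ha : a = 0
      · have hb : b ≠ 0 := fun hb => hab ⟨ha, hb⟩
        rw [neg_sq]
        positivity
      · positivity
    by_cases h2 : x₂ = 0 ∧ y₂ = 0
    · by_cases h3 : x₃ = 0 ∧ y₃ = 0
      · exact ⟨1, 0, by norm_num, by simp [h2], by simp [h3]⟩
      · exact ⟨-y₃, x₃, key h3, by linear_combination -hΔ, by ring⟩
    · exact ⟨-y₂, x₂, key h2, by ring, by linear_combination hΔ⟩
  set N := m ^ 2 + n ^ 2 with hN
  set b := e * m + f * n with hb
  -- From completing the square in $|(e,f)+s(m,n)|^2=L$: the equation reads $(Ns+b)^2=r^2$.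
  set r := Real.sqrt (b ^ 2 + N * (L - (e ^ 2 + f ^ 2))) with hr
  have hr2 : r ^ 2 = b ^ 2 + N * (L - (e ^ 2 + f ^ 2)) :=
    Real.sq_sqrt (add_nonneg (sq_nonneg _) (mul_nonneg hmn.le (sub_nonneg.2 hL)))
  obtain ⟨s, hs⟩ : ∃ s, N * s = r - b := ⟨(r - b) / N, mul_div_cancel₀ _ hmn.ne'⟩
  refine ⟨e + s * m, f + s * n, ?_, by linear_combination h2 + s * hm2,
    by linear_combination h3 + s * hm3⟩
  refine mul_left_cancel₀ hmn.ne' ?_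
  have : (N * s + b) ^ 2 = r ^ 2 := by rw [hs]; ring
  rw [hr2] at this
  linear_combination this - N * s ^ 2 * hN - 2 * N * s * hb

/-- In the closure of the set where the defect is positive, its zeros are realised by a common
point of the three circles, even if their centres are collinear. -/
lemma exists_of_mem_closure_pos {x₂ y₂ x₃ y₃ : ℝ → ℝ} (hx₂ : Continuous x₂) (hy₂ : Continuous y₂)
    (hx₃ : Continuous x₃) (hy₃ : Continuous y₃) {L₁ L₂ L₃ t : ℝ}
    (h0 : circleDefect L₁ L₂ L₃ (x₂ t) (y₂ t) (x₃ t) (y₃ t) = 0)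
    (ht : t ∈ closure {t | 0 < circleDefect L₁ L₂ L₃ (x₂ t) (y₂ t) (x₃ t) (y₃ t)}) :
    ∃ e f : ℝ, e ^ 2 + f ^ 2 = L₁ ∧ (e - x₂ t) ^ 2 + (f - y₂ t) ^ 2 = L₂ ∧
      (e - x₃ t) ^ 2 + (f - y₃ t) ^ 2 = L₃ := by
  by_cases hΔ : x₂ t * y₃ t - x₃ t * y₂ t = 0
  swap
  · exact exists_of_circleDefect_eq_zero h0 hΔ
  set R := Real.sqrt L₁
  let K := Set.Icc (-R) R ×ˢ Set.Icc (-R) R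
  have hKc : IsCompact K := isCompact_Icc.prod isCompact_Icc
  have : CompactSpace K := isCompact_iff_compactSpace.1 hKc
  -- Points of the first disc on both radical axes. Where the defect is positive the radical centre
  -- is such a point, and by compactness this persists in the limit.
  let C : Set (ℝ × K) := {z | z.2.1.1 ^ 2 + z.2.1.2 ^ 2 ≤ L₁ ∧
    z.2.1.1 * x₂ z.1 + z.2.1.2 * y₂ z.1 = (x₂ z.1 ^ 2 + y₂ z.1 ^ 2 - L₂ + L₁) / 2 ∧
    z.2.1.1 * x₃ z.1 + z.2.1.2 * y₃ z.1 = (x₃ z.1 ^ 2 + y₃ z.1 ^ 2 - L₃ + L₁) / 2}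
  have hC : IsClosed C := by
    simp only [C, Set.ofPred_and]
    refine IsClosed.inter (isClosed_le (by fun_prop) (by fun_prop))
      (IsClosed.inter (isClosed_eq (by fun_prop) (by fun_prop))
        (isClosed_eq (by fun_prop) (by fun_prop)))
  have hproj : IsClosed (Prod.fst '' C) := isClosedMap_fst_of_compactSpace C hC
  have hsub : {t | 0 < circleDefect L₁ L₂ L₃ (x₂ t) (y₂ t) (x₃ t) (y₃ t)} ⊆ Prod.fst '' C := by
    intro s hs
    have hΔs : x₂ s * y₃ s - x₃ s * y₂ s ≠ 0 := fun h =>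
      absurd hs (not_lt.2 (circleDefect_nonpos_of_cross_eq_zero L₂ L₃ h))
    obtain ⟨e, f, h2, h3, h1⟩ := exists_radicalCentre L₁ L₂ L₃ hΔs
    have hpos : 0 < L₁ - (e ^ 2 + f ^ 2) := by
      have hs' : 0 < circleDefect L₁ L₂ L₃ (x₂ s) (y₂ s) (x₃ s) (y₃ s) := hs
      rw [← h1] at hs'
      exact pos_of_mul_pos_left hs' (sq_nonneg _)
    have he : |e| ≤ R := Real.abs_le_sqrt (by linarith [sq_nonneg f])
    have hf : |f| ≤ R := Real.abs_le_sqrt (by linarith [sq_nonneg e])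
    exact ⟨(s, ⟨(e, f), abs_le.1 he, abs_le.1 hf⟩), ⟨by linarith, h2, h3⟩, rfl⟩
  obtain ⟨⟨s, ⟨⟨e, f⟩, hef⟩⟩, ⟨h1, h2, h3⟩, rfl⟩ := closure_minimal hsub hproj ht
  obtain ⟨e', f', h1', h2', h3'⟩ := exists_of_cross_eq_zero hΔ h1 h2 h3
  exact ⟨e', f', h1', by linear_combination h1' - 2 * h2', by linear_combination h1' - 2 * h3'⟩

/-- Two triangles `(x i, y i)` and `(g i, h i)` joined by three bars: the second triangle can be
rotated to another position in which the bars have the same lengths. -/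
theorem exists_other_prism_realisation {x y g h : Fin 3 → ℝ}
    (hΔ : (x 1 - x 0 - (g 1 - g 0)) * (y 2 - y 0 - (h 2 - h 0)) -
      (x 2 - x 0 - (g 2 - g 0)) * (y 1 - y 0 - (h 1 - h 0)) ≠ 0)
    (hrig : ∀ u v : ℝ, (∀ i, (x i - g i) * (u - h i) + (y i - h i) * (v + g i) = 0) → False) :
    ∃ c s a b : ℝ, c ^ 2 + s ^ 2 = 1 ∧ c ≠ 1 ∧
      ∀ i, (x i - (a + (c * g i - s * h i))) ^ 2 + (y i - (b + (s * g i + c * h i))) ^ 2 =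
        (x i - g i) ^ 2 + (y i - h i) ^ 2 := by
  -- After rotating the second triangle by `t`, its translation vector must lie on three circles.
  -- Their centres are written relative to the first.
  let X (i : Fin 3) (t : ℝ) : ℝ :=
    x i - x 0 - (Real.cos t * (g i - g 0) - Real.sin t * (h i - h 0))
  let Y (i : Fin 3) (t : ℝ) : ℝ :=
    y i - y 0 - (Real.sin t * (g i - g 0) + Real.cos t * (h i - h 0))
  have hXc : ∀ i, Continuous (X i) := fun i => by fun_prop
  have hYc : ∀ i, Continuous (Y i) := fun i => by fun_prop
  let F (t : ℝ) : ℝ := circleDefect ((x 0 - g 0) ^ 2 + (y 0 - h 0) ^ 2)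
    ((x 1 - g 1) ^ 2 + (y 1 - h 1) ^ 2) ((x 2 - g 2) ^ 2 + (y 2 - h 2) ^ 2)
    (X 1 t) (Y 1 t) (X 2 t) (Y 2 t)
  have hX0 : ∀ i, X i 0 = x i - x 0 - (g i - g 0) := fun i => by simp [X]
  have hY0 : ∀ i, Y i 0 = y i - y 0 - (h i - h 0) := fun i => by simp [Y]
  have hX : ∀ i, HasDerivAt (X i) (h i - h 0) 0 := fun i => by
    refine ((((Real.hasDerivAt_cos 0).mul_const (g i - g 0)).fun_sub
      ((Real.hasDerivAt_sin 0).mul_const (h i - h 0))).const_sub (x i - x 0)).congr_deriv ?_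
    simp
  have hY : ∀ i, HasDerivAt (Y i) (-(g i - g 0)) 0 := fun i => by
    refine ((((Real.hasDerivAt_sin 0).mul_const (g i - g 0)).fun_add
      ((Real.hasDerivAt_cos 0).mul_const (h i - h 0))).const_sub (y i - y 0)).congr_deriv ?_
    simp
  have hFc : Continuous F := by
    have := hXc 1
    have := hXc 2
    have := hYc 1
    have := hYc 2
    simp only [F, circleDefect]
    fun_prop
  have hFper : Function.Periodic F (2 * Real.pi) := fun t => by simp [F, X, Y]
  have e1 : (g 0 - x 0) ^ 2 + (h 0 - y 0) ^ 2 = (x 0 - g 0) ^ 2 + (y 0 - h 0) ^ 2 := by ring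
  have e2 : ∀ i, (g 0 - x 0 - X i 0) ^ 2 + (h 0 - y 0 - Y i 0) ^ 2 =
      (x i - g i) ^ 2 + (y i - h i) ^ 2 := fun i => by rw [hX0, hY0]; ring
  have hF0 : F 0 = 0 := circleDefect_eq_zero e1 (e2 1) (e2 2)
  obtain ⟨u, v, hu, hv, hd⟩ := hasDerivAt_circleDefect (hX 1) (hY 1) (hX 2) (hY 2)
    (by simpa only [hX0, hY0] using hΔ) e1 (e2 1) (e2 2)
  have hD : -2 * (X 1 0 * Y 2 0 - X 2 0 * Y 1 0) ^ 2 *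
      ((g 0 - x 0) * u + (h 0 - y 0) * v) ≠ 0 := by
    simp only [hX0, hY0] at hu hv ⊢
    refine mul_ne_zero (mul_ne_zero (by norm_num) (pow_ne_zero 2 hΔ)) fun he => ?_
    -- The translational velocity that accompanies rotation about the origin at unit speed.
    refine hrig (u + h 0) (v - g 0) fun i => ?_
    fin_cases i
    · simp only [Fin.zero_eta]
      linear_combination -he
    · simp only [Fin.mk_one]
      linear_combination hu - he
    · simp only [Fin.reduceFinMk]
      linear_combination hv - he
  obtain ⟨t, ht, ht0, htcl⟩ := hFper.exists_zero_mem_closure_pos Real.two_pi_pos hFc hF0 hd hD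
  obtain ⟨e, f, h1, h2, h3⟩ := exists_of_mem_closure_pos (hXc 1) (hYc 1) (hXc 2) (hYc 2) ht0 htcl
  refine ⟨Real.cos t, Real.sin t, x 0 - (Real.cos t * g 0 - Real.sin t * h 0) + e,
    y 0 - (Real.sin t * g 0 + Real.cos t * h 0) + f, Real.cos_sq_add_sin_sq t, fun hc => ?_,
    fun i => ?_⟩
  · rw [Real.cos_eq_one_iff_of_lt_of_lt (by linarith [ht.1, Real.pi_pos]) ht.2] at hc
    exact ht.1.ne' hc
  · simp only [X, Y] at h2 h3
    fin_cases i
    · simp only [Fin.zero_eta]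
      linear_combination h1
    · simp only [Fin.mk_one]
      linear_combination h2
    · simp only [Fin.reduceFinMk]
      linear_combination h3

/-! ### Invariance under isomorphism -/

namespace Realisation

variable {V W : Type*}

lemma Generic.comp {p : Realisation W} (hp : p.Generic) {e : V → W} (he : Function.Injective e) :
    Generic (p ∘ e : Realisation V) :=
  AlgebraicIndependent.comp hp (Prod.map e id) (he.prodMap Function.injective_id)

variable {G : SimpleGraph V} {H : SimpleGraph W} (e : G ≃g H)

lemma Equivalent.symm {p q : Realisation V} (h : Equivalent G p q) : Equivalent G q p :=
  fun x y hxy => (h x y hxy).symm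

lemma equivalent_comp_iso {p : Realisation V} {q : Realisation W}
    (h : Equivalent G p (q ∘ e)) : Equivalent H (p ∘ e.symm) q := fun x y hxy => by
  simpa using h (e.symm x) (e.symm y) (e.symm.map_rel_iff.2 hxy)

lemma congruent_comp_iso {p : Realisation V} {q : Realisation W}
    (h : Congruent (p ∘ e.symm) q) : Congruent p (q ∘ e) := fun x y => by
  simpa using h (e x) (e y)

lemma GloballyRigid.comp_iso {p : Realisation W} (h : p.GloballyRigid H) :
    GloballyRigid G (p ∘ e : Realisation V) := fun _ hq =>
  (congruent_comp_iso e (h _ (equivalent_comp_iso e hq.symm).symm).symm).symm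

lemma Rigid.comp_iso {p : Realisation W} (h : p.Rigid H) :
    Rigid G (p ∘ e : Realisation V) := by
  obtain ⟨ε, hε, h⟩ := h
  refine ⟨ε, hε, fun q hq hclose => ?_⟩
  refine (congruent_comp_iso e (h _ (equivalent_comp_iso e hq.symm).symm fun x => ?_).symm).symm
  simpa using hclose (e.symm x)

end Realisation

namespace SimpleGraph

variable {V W : Type*} {G : SimpleGraph V} {H : SimpleGraph W}

lemma Iso.isGloballyRigid (e : G ≃g H) (h : H.IsGloballyRigid) : G.IsGloballyRigid := by
  obtain ⟨p, hp, hg⟩ := h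
  exact ⟨p ∘ e, hp.comp e.injective, hg.comp_iso e⟩

lemma Iso.isRigid (e : G ≃g H) (h : H.IsRigid) : G.IsRigid := by
  obtain ⟨p, hp, hg⟩ := h
  exact ⟨p ∘ e, hp.comp e.injective, hg.comp_iso e⟩

lemma isGloballyRigid_top (V : Type*) [Finite V] : (⊤ : SimpleGraph V).IsGloballyRigid := by
  obtain ⟨p, hp⟩ := Realisation.exists_generic V
  refine ⟨p, hp, fun q hq => ?_⟩
  rw [congruent_iff_dist_eq]
  intro x y
  by_cases hxy : x = y
  · simp [hxy]
  · simpa only [dist_eq_norm] using hq x y hxy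

lemma IsGloballyRigid.isRigid (h : G.IsGloballyRigid) : G.IsRigid := by
  obtain ⟨p, hp, hg⟩ := h
  exact ⟨p, hp, hg.rigid⟩

end SimpleGraph

lemma Realisation.Generic.coord_ne {V : Type*} {p : Realisation V} (hp : p.Generic) {x y : V}
    (hxy : x ≠ y) : p x 1 ≠ p y 1 := by
  intro h
  have := (AlgebraicIndependent.injective hp) (a₁ := (x, 1)) (a₂ := (y, 1)) h
  simp [hxy] at this

lemma SimpleGraph.isRigid_of_pinnedRigid {V : Type*} [Fintype V] [DecidableEq V]
    {G : SimpleGraph V} {u w : V} (huw : u ≠ w) {m : V × Fin 2 → ℝ}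
    (hm : G.PinnedRigid u w m) : G.IsRigid := by
  classical
  obtain ⟨p, hp⟩ := Realisation.exists_generic V
  exact ⟨p, hp, (hp.pinnedRigid G u w hm).rigid G (hp.coord_ne huw.symm)⟩

lemma eq_zero_of_cross_ne_zero {x₁ y₁ x₂ y₂ u v : ℝ} (h : x₁ * y₂ - x₂ * y₁ ≠ 0)
    (h1 : x₁ * u + y₁ * v = 0) (h2 : x₂ * u + y₂ * v = 0) : u = 0 ∧ v = 0 :=
  ⟨(mul_eq_zero.1 (by linear_combination y₂ * h1 - y₁ * h2)).resolve_left h,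
    (mul_eq_zero.1 (by linear_combination x₁ * h2 - x₂ * h1)).resolve_left h⟩

/-! ### The complete bipartite graph -/

section CompleteBipartite

/-- The test placement avoids conics: three of the points lie on a line and the other three are not
collinear. The kernel is computed from nine edge and three pinning equations in twelve unknowns. -/
lemma pinnedRigid_completeBipartiteGraph :
    (completeBipartiteGraph (Fin 3) (Fin 3)).PinnedRigid (.inl 0) (.inl 1)
      (fun c => Sum.elim ![![0, 0], ![0, 1], ![1, 0]] ![![1, 1], ![2, 0], ![0, 3]] c.1 c.2) := by
  intro v hv
  rw [SimpleGraph.pinnedRigidityMatrix_mulVec_eq_zero_iff] at hv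
  obtain ⟨h, h0, h1, h2⟩ := hv
  have e00 := h (.inl 0) (.inr 0) (by simp)
  have e01 := h (.inl 0) (.inr 1) (by simp)
  have e02 := h (.inl 0) (.inr 2) (by simp)
  have e10 := h (.inl 1) (.inr 0) (by simp)
  have e11 := h (.inl 1) (.inr 1) (by simp)
  have e12 := h (.inl 1) (.inr 2) (by simp)
  have e20 := h (.inl 2) (.inr 0) (by simp)
  have e21 := h (.inl 2) (.inr 1) (by simp)
  have e22 := h (.inl 2) (.inr 2) (by simp)
  clear h
  simp [-mul_eq_zero, h0, h1, h2] at e00 e01 e02 e10 e11 e12 e20 e21 e22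
  funext ⟨x, i⟩
  rcases x with x | x <;> fin_cases x <;> fin_cases i <;> simp <;> linarith

lemma SimpleGraph.isRigid_completeBipartiteGraph :
    (completeBipartiteGraph (Fin 3) (Fin 3)).IsRigid :=
  isRigid_of_pinnedRigid (by decide) pinnedRigid_completeBipartiteGraph

/-- Complex division of $a+bi$ by $u+vi$. Used as a frame, it scales squared lengths by $u^2+v^2$.
-/
lemma exists_frame {u v : ℝ} (h : u ^ 2 + v ^ 2 ≠ 0) (a b : ℝ) :
    ∃ x y : ℝ, a = x * u - y * v ∧ b = x * v + y * u := by
  refine ⟨(a * u + b * v) / (u ^ 2 + v ^ 2), (b * u - a * v) / (u ^ 2 + v ^ 2), ?_, ?_⟩ <;>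
  · field_simp
    ring

theorem Realisation.Generic.not_globallyRigid_completeBipartiteGraph
    {p : Realisation (Fin 3 ⊕ Fin 3)} (hp : p.Generic) :
    ¬ p.GloballyRigid (completeBipartiteGraph (Fin 3) (Fin 3)) := by
  classical
  intro hglob
  have hcrossB : ∀ z : Fin 3 ⊕ Fin 3, z ≠ .inr 0 → z ≠ .inr 1 → _ := fun z h0 h1 =>
    hp.cross_ne_zero (x := .inr 0) (y := .inr 1) (z := z) (by simp) h0.symm h1.symm
  have hcrossA := hp.cross_ne_zero (x := .inl 0) (y := .inl 1) (z := .inl 2)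
    (by simp) (by simp) (by simp)
  obtain ⟨u, hu⟩ : ∃ u, p (.inr 1) 0 = p (.inr 0) 0 + u := ⟨_, (add_sub_cancel _ _).symm⟩
  obtain ⟨v, hv⟩ : ∃ v, p (.inr 1) 1 = p (.inr 0) 1 + v := ⟨_, (add_sub_cancel _ _).symm⟩
  have hR : u ^ 2 + v ^ 2 ≠ 0 := by
    intro h
    have hu0 : u = 0 := by nlinarith
    have hv0 : v = 0 := by nlinarith
    refine hcrossB (.inr 2) (by simp) (by simp) ?_
    rw [hu, hv, hu0, hv0]
    ring
  have hframe : ∀ z, ∃ x y : ℝ, p z 0 = p (.inr 0) 0 + (x * u - y * v) ∧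
      p z 1 = p (.inr 0) 1 + (x * v + y * u) := fun z => by
    obtain ⟨x, y, h1, h2⟩ := exists_frame hR (p z 0 - p (.inr 0) 0) (p z 1 - p (.inr 0) 1)
    exact ⟨x, y, by linarith, by linarith⟩
  choose x y hx hy using fun i => hframe (.inl i)
  obtain ⟨g, h, hg, hh⟩ := hframe (.inr 2)
  have hy0 : ∀ i, y i ≠ 0 := fun i hi => by
    refine hcrossB (.inl i) (by simp) (by simp) ?_
    rw [hx, hy, hu, hv, hi]
    ring
  have hh0 : h ≠ 0 := fun h0 => by
    refine hcrossB (.inr 2) (by simp) (by simp) ?_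
    rw [hg, hh, hu, hv, h0]
    ring
  have hΔ : (x 1 - x 0) * (y 2 - y 0) - (x 2 - x 0) * (y 1 - y 0) ≠ 0 := fun h0 => by
    refine hcrossA ?_
    simp only [hx, hy]
    linear_combination (u ^ 2 + v ^ 2) * h0
  have hrig := hp.pinnedRigid _ _ _ pinnedRigid_completeBipartiteGraph
  obtain ⟨s, g', h', X, Y, hs, h1, h2, h3, hne⟩ :=
    BipartiteLinkage.exists_other_realisation (g := g) hy0 hh0 hΔ (by
      -- Such a motion fixes $b_0$ and moves $b_1$ along $b_1-b_0$. Infinitesimal rigidity would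
      -- preserve their distance to first order, forcing $u^2+v^2=0$.
      intro a b c d ha hb hc
      have key := hrig.infinitesimal (completeBipartiteGraph (Fin 3) (Fin 3))
        (hp.coord_ne (by simp))
        (v := fun z => Sum.elim (fun i => ![a i * u - b i * v, a i * v + b i * u])
          (![![0, 0], ![u, v], ![c * u - d * v, c * v + d * u]]) z.1 z.2) (by
          have hedge : ∀ i j, (p (.inl i) 0 - p (.inr j) 0) * ((a i * u - b i * v) -
              ![![0, 0], ![u, v], ![c * u - d * v, c * v + d * u]] j 0) +
              (p (.inl i) 1 - p (.inr j) 1) * ((a i * v + b i * u) -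
              ![![0, 0], ![u, v], ![c * u - d * v, c * v + d * u]] j 1) = 0 := by
            intro i j
            fin_cases j
            · simp [hx, hy]
              linear_combination (u ^ 2 + v ^ 2) * ha i
            · simp [hx, hy, hu, hv]
              linear_combination (u ^ 2 + v ^ 2) * hb i
            · simp [hx, hy, hg, hh]
              linear_combination (u ^ 2 + v ^ 2) * hc i
          rintro (i | j) (i' | j') hadj
          · simp at hadj
          · exact hedge i j'
          · have := hedge i' j
            simp only [Sum.elim_inl, Sum.elim_inr, Matrix.cons_val_zero, Matrix.cons_val_one] at *
            linear_combination this
          · simp at hadj) (.inr 1) (.inr 0)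
      simp [hu, hv] at key
      apply hR
      linear_combination key)
  let q : Realisation (Fin 3 ⊕ Fin 3) := Sum.elim
    (fun i => !₂[p (.inr 0) 0 + (X i * u - Y i * v), p (.inr 0) 1 + (X i * v + Y i * u)])
    ![p (.inr 0), !₂[p (.inr 0) 0 + s * u, p (.inr 0) 1 + s * v],
      !₂[p (.inr 0) 0 + (g' * u - h' * v), p (.inr 0) 1 + (g' * v + h' * u)]]
  have hequiv : Equivalent (completeBipartiteGraph (Fin 3) (Fin 3)) p q := by
    rw [equivalent_iff]
    have hedge : ∀ i j, (p (.inl i) 0 - p (.inr j) 0) ^ 2 + (p (.inl i) 1 - p (.inr j) 1) ^ 2 =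
        (q (.inl i) 0 - q (.inr j) 0) ^ 2 + (q (.inl i) 1 - q (.inr j) 1) ^ 2 := by
      intro i j
      fin_cases j
      · simp [q, hx, hy]
        linear_combination -(u ^ 2 + v ^ 2) * h1 i
      · simp [q, hx, hy, hu, hv]
        linear_combination -(u ^ 2 + v ^ 2) * h2 i
      · simp [q, hx, hy, hg, hh]
        linear_combination -(u ^ 2 + v ^ 2) * h3 i
    rintro (i | j) (i' | j') hadj
    · simp at hadj
    · exact hedge i j'
    · linear_combination hedge i' j
    · simp at hadj
  have hcong := (congruent_iff p q).1 (hglob q hequiv)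
  refine hne ⟨?_, fun i j => ?_⟩
  · have := hcong (.inr 1) (.inr 0)
    simp [q, hu, hv] at this
    have hs2 : s ^ 2 = 1 := mul_left_cancel₀ hR (by linear_combination -this)
    nlinarith
  · have := hcong (.inl i) (.inl j)
    simp [q, hx, hy] at this
    exact mul_left_cancel₀ hR (by linear_combination -this)

end CompleteBipartite

/-! ### The triangular prism -/

section Prism

lemma prism_adj_zero (i j : Fin 3) (h : i ≠ j) (k : Fin 2) :
    ((⊤ : SimpleGraph (Fin 2)).boxProd (⊤ : SimpleGraph (Fin 3))).Adj (k, i) (k, j) := by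
  simpa using h

lemma prism_adj_one (i : Fin 3) {k l : Fin 2} (h : k ≠ l) :
    ((⊤ : SimpleGraph (Fin 2)).boxProd (⊤ : SimpleGraph (Fin 3))).Adj (k, i) (l, i) := by
  simpa using h

lemma pinnedRigid_prism :
    ((⊤ : SimpleGraph (Fin 2)).boxProd (⊤ : SimpleGraph (Fin 3))).PinnedRigid (0, 0) (0, 1)
      (fun c => ![![![0, 0], ![0, 1], ![1, 0]], ![![1, 0], ![1, 1], ![2, 1]]] c.1.1 c.1.2 c.2) := by
  intro v hv
  rw [SimpleGraph.pinnedRigidityMatrix_mulVec_eq_zero_iff] at hv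
  obtain ⟨h, h0, h1, h2⟩ := hv
  have a01 := h _ _ (prism_adj_zero 0 1 (by decide) 0)
  have a02 := h _ _ (prism_adj_zero 0 2 (by decide) 0)
  have a12 := h _ _ (prism_adj_zero 1 2 (by decide) 0)
  have b01 := h _ _ (prism_adj_zero 0 1 (by decide) 1)
  have b02 := h _ _ (prism_adj_zero 0 2 (by decide) 1)
  have b12 := h _ _ (prism_adj_zero 1 2 (by decide) 1)
  have e0 := h _ _ (prism_adj_one 0 zero_ne_one)
  have e1 := h _ _ (prism_adj_one 1 zero_ne_one)
  have e2 := h _ _ (prism_adj_one 2 zero_ne_one)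
  clear h
  simp [-mul_eq_zero, h0, h1, h2] at a01 a02 a12 b01 b02 b12 e0 e1 e2
  funext ⟨⟨k, x⟩, i⟩
  fin_cases k <;> fin_cases x <;> fin_cases i <;> simp <;> linarith

lemma SimpleGraph.isRigid_prism :
    ((⊤ : SimpleGraph (Fin 2)).boxProd (⊤ : SimpleGraph (Fin 3))).IsRigid :=
  isRigid_of_pinnedRigid (by decide) pinnedRigid_prism

theorem Realisation.Generic.not_globallyRigid_prism
    {p : Realisation (Fin 2 × Fin 3)} (hp : p.Generic) :
    ¬ p.GloballyRigid ((⊤ : SimpleGraph (Fin 2)).boxProd (⊤ : SimpleGraph (Fin 3))) := by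
  classical
  intro hglob
  have hA := hp.cross_ne_zero (x := (0, 0)) (y := (0, 1)) (z := (0, 2))
    (by simp) (by simp) (by simp)
  have hB : (p (1, 1) 0 - p (1, 0) 0) ^ 2 + (p (1, 1) 1 - p (1, 0) 1) ^ 2 ≠ 0 := fun h0 => by
    have := hp.coord_ne (x := (1, 1)) (y := (1, 0)) (by simp)
    have h1 : 0 < (p (1, 1) 1 - p (1, 0) 1) ^ 2 := by
      have := sub_ne_zero.2 this
      positivity
    linarith [sq_nonneg (p (1, 1) 0 - p (1, 0) 0)]
  have hΔ : (p (0, 1) 0 - p (0, 0) 0 - (p (1, 1) 0 - p (1, 0) 0)) *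
      (p (0, 2) 1 - p (0, 0) 1 - (p (1, 2) 1 - p (1, 0) 1)) -
      (p (0, 2) 0 - p (0, 0) 0 - (p (1, 2) 0 - p (1, 0) 0)) *
      (p (0, 1) 1 - p (0, 0) 1 - (p (1, 1) 1 - p (1, 0) 1)) ≠ 0 := by
    have := hp.aeval_ne_zero_of
      (P := (.X ((0, 1), 0) - .X ((0, 0), 0) - (.X ((1, 1), 0) - .X ((1, 0), 0))) *
      (.X ((0, 2), 1) - .X ((0, 0), 1) - (.X ((1, 2), 1) - .X ((1, 0), 1))) -
      (.X ((0, 2), 0) - .X ((0, 0), 0) - (.X ((1, 2), 0) - .X ((1, 0), 0))) *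
      (.X ((0, 1), 1) - .X ((0, 0), 1) - (.X ((1, 1), 1) - .X ((1, 0), 1))))
      (fun c => if c = ((0, 1), 0) then 1 else if c = ((0, 2), 1) then 1 else 0) (by simp)
    simpa using this
  have hrig := hp.pinnedRigid _ _ _ pinnedRigid_prism
  obtain ⟨c, s, a, b, hcs, hc1, hbar⟩ := exists_other_prism_realisation
    (x := fun i => p (0, i) 0) (y := fun i => p (0, i) 1) (g := fun i => p (1, i) 0)
    (h := fun i => p (1, i) 1) hΔ (by
      intro u v huv
      have key := hrig.infinitesimal ((⊤ : SimpleGraph (Fin 2)).boxProd (⊤ : SimpleGraph (Fin 3)))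
        (hp.coord_ne (by simp))
        (v := fun z => if z.1.1 = 0 then 0 else
          if z.2 = 0 then u - p (1, z.1.2) 1 else v + p (1, z.1.2) 0) (by
          rintro ⟨k, i⟩ ⟨l, j⟩ hadj
          rw [SimpleGraph.boxProd_adj] at hadj
          rcases hadj with ⟨hkl, rfl : i = j⟩ | ⟨-, rfl : k = l⟩
          · fin_cases k <;> fin_cases l <;> simp at hkl ⊢
            · linear_combination -huv i
            · linear_combination -huv i
          · fin_cases k <;> simp
            ring)
      -- The first triangle is at rest and not collinear, so a motion preserving distances to it is
      -- zero. But a rotation at unit speed cannot fix two distinct points.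
      have hzero : ∀ j, u - p (1, j) 1 = 0 ∧ v + p (1, j) 0 = 0 := by
        intro j
        have h0 := key (0, 0) (1, j)
        have h1 := key (0, 1) (1, j)
        have h2 := key (0, 2) (1, j)
        simp at h0 h1 h2
        refine eq_zero_of_cross_ne_zero hA ?_ ?_
        · linear_combination h0 - h1
        · linear_combination h0 - h2
      apply hB
      obtain ⟨h0, h0'⟩ := hzero 0
      obtain ⟨h1, h1'⟩ := hzero 1
      have e0 : p (1, 1) 0 - p (1, 0) 0 = 0 := by linarith
      have e1 : p (1, 1) 1 - p (1, 0) 1 = 0 := by linarith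
      rw [e0, e1]
      ring)
  let q : Realisation (Fin 2 × Fin 3) := fun z => if z.1 = 0 then p z else
    !₂[a + (c * p (1, z.2) 0 - s * p (1, z.2) 1), b + (s * p (1, z.2) 0 + c * p (1, z.2) 1)]
  have hequiv : Equivalent ((⊤ : SimpleGraph (Fin 2)).boxProd (⊤ : SimpleGraph (Fin 3))) p q := by
    rw [equivalent_iff]
    rintro ⟨k, i⟩ ⟨l, j⟩ hadj
    rw [SimpleGraph.boxProd_adj] at hadj
    rcases hadj with ⟨hkl, rfl : i = j⟩ | ⟨-, rfl : k = l⟩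
    · fin_cases k <;> fin_cases l <;> simp [q] at hkl ⊢
      · linear_combination -hbar i
      · linear_combination -hbar i
    · fin_cases k <;> simp [q]
      linear_combination -((p (1, i) 0 - p (1, j) 0) ^ 2 + (p (1, i) 1 - p (1, j) 1) ^ 2) * hcs
  have hcong := (congruent_iff p q).1 (hglob q hequiv)
  -- A point is determined by its distances to three noncollinear points, so congruence would make
  -- the rotated triangle coincide with the original.
  have hfix : ∀ j, a + (c * p (1, j) 0 - s * p (1, j) 1) - p (1, j) 0 = 0 ∧
      b + (s * p (1, j) 0 + c * p (1, j) 1) - p (1, j) 1 = 0 := by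
    intro j
    have h0 := hcong (0, 0) (1, j)
    have h1 := hcong (0, 1) (1, j)
    have h2 := hcong (0, 2) (1, j)
    simp [q] at h0 h1 h2
    refine eq_zero_of_cross_ne_zero hA ?_ ?_
    · linear_combination (h1 - h0) / 2
    · linear_combination (h2 - h0) / 2
  have hzero : ((c - 1) ^ 2 + s ^ 2) *
      ((p (1, 1) 0 - p (1, 0) 0) ^ 2 + (p (1, 1) 1 - p (1, 0) 1) ^ 2) = 0 := by
    obtain ⟨h0, h0'⟩ := hfix 0
    obtain ⟨h1, h1'⟩ := hfix 1
    have e0 : (c - 1) * (p (1, 1) 0 - p (1, 0) 0) - s * (p (1, 1) 1 - p (1, 0) 1) = 0 := by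
      linear_combination h1 - h0
    have e1 : s * (p (1, 1) 0 - p (1, 0) 0) + (c - 1) * (p (1, 1) 1 - p (1, 0) 1) = 0 := by
      linear_combination h1' - h0'
    linear_combination ((c - 1) * (p (1, 1) 0 - p (1, 0) 0) - s * (p (1, 1) 1 - p (1, 0) 1)) * e0 +
      (s * (p (1, 1) 0 - p (1, 0) 0) + (c - 1) * (p (1, 1) 1 - p (1, 0) 1)) * e1
  have := (mul_eq_zero.1 hzero).resolve_right hB
  refine hc1 (sub_eq_zero.1 (pow_eq_zero_iff two_ne_zero |>.1 ?_))
  exact le_antisymm (by linarith [sq_nonneg s]) (sq_nonneg _)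

end Prism

/-! ### Cubic graphs on at most six vertices -/

namespace SimpleGraph

section Cubic

variable {V W : Type*} {G : SimpleGraph V} {H : SimpleGraph W}

lemma IsRegularOfDegree.of_iso [G.LocallyFinite] [H.LocallyFinite] (e : G ≃g H) {d : ℕ}
    (h : H.IsRegularOfDegree d) : G.IsRegularOfDegree d := fun v => by
  rw [← e.degree_eq v]
  exact h (e v)

/-- A bijective homomorphism between regular graphs of the same degree is an isomorphism. -/
lemma nonempty_iso_of_regular [G.LocallyFinite] [H.LocallyFinite] {d : ℕ}
    (hG : G.IsRegularOfDegree d) (hH : H.IsRegularOfDegree d) (f : H →g G)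
    (hf : Function.Bijective f) : Nonempty (G ≃g H) := by
  classical
  refine ⟨(RelIso.symm ⟨Equiv.ofBijective f hf, fun {i j} => ⟨fun hij => ?_, f.map_rel⟩⟩)⟩
  have hsub : (H.neighborFinset i).image f ⊆ G.neighborFinset (f i) := by
    intro x hx
    obtain ⟨k, hk, rfl⟩ := Finset.mem_image.1 hx
    rw [mem_neighborFinset] at hk ⊢
    exact f.map_rel hk
  have heq := Finset.eq_of_subset_of_card_le hsub (by
    rw [Finset.card_image_of_injective _ hf.1, card_neighborFinset_eq_degree,
      card_neighborFinset_eq_degree, hG, hH])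
  have hmem : f j ∈ G.neighborFinset (f i) := by
    rw [mem_neighborFinset]
    exact hij
  rw [← heq] at hmem
  obtain ⟨k, hk, hkj⟩ := Finset.mem_image.1 hmem
  rw [← hf.1 hkj]
  exact (mem_neighborFinset _ _ _).1 hk

instance decidableRelAdjCompleteBipartiteGraph :
    DecidableRel (completeBipartiteGraph (Fin 3) (Fin 3)).Adj := fun v w =>
  inferInstanceAs (Decidable (v.isLeft ∧ w.isRight ∨ v.isRight ∧ w.isLeft))

lemma degree_completeBipartiteGraph_fin_three (v : Fin 3 ⊕ Fin 3) :
    (completeBipartiteGraph (Fin 3) (Fin 3)).degree v = 3 := by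
  revert v
  decide

lemma isRegularOfDegree_completeBipartiteGraph
    [(completeBipartiteGraph (Fin 3) (Fin 3)).LocallyFinite] :
    (completeBipartiteGraph (Fin 3) (Fin 3)).IsRegularOfDegree 3 := by
  intro v
  convert degree_completeBipartiteGraph_fin_three v

lemma isRegularOfDegree_prism
    [((⊤ : SimpleGraph (Fin 2)).boxProd (⊤ : SimpleGraph (Fin 3))).LocallyFinite] :
    ((⊤ : SimpleGraph (Fin 2)).boxProd (⊤ : SimpleGraph (Fin 3))).IsRegularOfDegree 3 := by
  intro v
  have key := degree_boxProd (G := (⊤ : SimpleGraph (Fin 2))) (H := (⊤ : SimpleGraph (Fin 3))) v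
  simp only [complete_graph_degree, Fintype.card_fin] at key
  convert key

lemma degree_top_fin_four (v : Fin 4) : (⊤ : SimpleGraph (Fin 4)).degree v = 3 := by
  simp

lemma isRegularOfDegree_top_four [(⊤ : SimpleGraph (Fin 4)).LocallyFinite] :
    (⊤ : SimpleGraph (Fin 4)).IsRegularOfDegree 3 := by
  intro v
  convert degree_top_fin_four v

variable [G.LocallyFinite]

lemma IsRegularOfDegree.exists_neighbors (hG : G.IsRegularOfDegree 3) (v : V) :
    ∃ a b c, a ≠ b ∧ a ≠ c ∧ b ≠ c ∧ ∀ t, G.Adj v t ↔ t = a ∨ t = b ∨ t = c := by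
  classical
  obtain ⟨a, b, c, hab, hac, hbc, h⟩ := Finset.card_eq_three.1
    ((G.card_neighborFinset_eq_degree v).trans (hG v))
  refine ⟨a, b, c, hab, hac, hbc, fun t => ?_⟩
  rw [← mem_neighborFinset, h]
  simp

/-- If all neighbours are among three vertices, these are the neighbours. -/
lemma IsRegularOfDegree.adj_of_subset (hG : G.IsRegularOfDegree 3) {v a b c : V}
    (h : ∀ t, G.Adj v t → t = a ∨ t = b ∨ t = c) : G.Adj v a ∧ G.Adj v b ∧ G.Adj v c := by
  classical
  have hsub : G.neighborFinset v ⊆ {a, b, c} := fun t ht => by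
    simpa using h t ((mem_neighborFinset _ _ _).1 ht)
  have heq := Finset.eq_of_subset_of_card_le hsub (by
    rw [card_neighborFinset_eq_degree, hG]
    exact Finset.card_le_three)
  refine ⟨?_, ?_, ?_⟩ <;>
  · rw [← mem_neighborFinset, heq]
    simp

/-- Three distinct neighbours are all the neighbours. -/
lemma IsRegularOfDegree.eq_of_adj (hG : G.IsRegularOfDegree 3) {v a b c t : V}
    (hab : a ≠ b) (hac : a ≠ c) (hbc : b ≠ c)
    (ha : G.Adj v a) (hb : G.Adj v b) (hc : G.Adj v c) (ht : G.Adj v t) :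
    t = a ∨ t = b ∨ t = c := by
  obtain ⟨x, y, z, -, -, -, h⟩ := hG.exists_neighbors v
  rw [h] at ha hb hc ht
  grind

variable [Fintype V]

lemma IsRegularOfDegree.three_mul_card (hG : G.IsRegularOfDegree 3) :
    3 * Fintype.card V = 2 * Nat.card G.edgeSet := by
  classical
  have h := G.sum_degrees_eq_twice_card_edges
  rw [edgeFinset_card, ← Nat.card_eq_fintype_card] at h
  have h' : ∑ v : V, G.degree v = 3 * Fintype.card V := by
    rw [Finset.sum_congr rfl fun v _ => (by convert hG v : G.degree v = 3), Finset.sum_const,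
      Finset.card_univ, smul_eq_mul, mul_comm]
  rw [← h']
  convert h

lemma IsRegularOfDegree.four_le_card (hG : G.IsRegularOfDegree 3) [Nonempty V] : 4 ≤ Fintype.card V := by
  classical
  obtain ⟨v⟩ := ‹Nonempty V›
  have h := Finset.card_le_univ (insert v (G.neighborFinset v))
  rw [Finset.card_insert_of_notMem (by simp), card_neighborFinset_eq_degree, hG] at h
  exact h

lemma IsRegularOfDegree.nonempty_iso_top (hG : G.IsRegularOfDegree 3) (hV : Fintype.card V = 4) :
    Nonempty (G ≃g (⊤ : SimpleGraph (Fin 4))) := by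
  classical
  obtain rfl : G = ⊤ := by
    ext x y
    rw [top_adj]
    refine ⟨fun h => h.ne, fun hxy => ?_⟩
    have hsub : G.neighborFinset x ⊆ Finset.univ.erase x := fun t ht => by
      simpa using ((mem_neighborFinset _ _ _).1 ht).ne'
    have heq := Finset.eq_of_subset_of_card_le hsub (by
      rw [Finset.card_erase_of_mem (Finset.mem_univ _), Finset.card_univ, hV,
        card_neighborFinset_eq_degree, hG])
    rw [← mem_neighborFinset, heq]
    simpa using hxy.symm
  exact ⟨Iso.completeGraph (Fintype.equivFinOfCardEq hV)⟩

/-- A triangle-free cubic graph on six vertices is `K₃,₃`. -/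
lemma IsRegularOfDegree.nonempty_iso_completeBipartiteGraph (hG : G.IsRegularOfDegree 3)
    (hV : Fintype.card V = 6) (htri : ∀ a b c, G.Adj a b → G.Adj b c → ¬ G.Adj a c) :
    Nonempty (G ≃g completeBipartiteGraph (Fin 3) (Fin 3)) := by
  classical
  obtain ⟨v⟩ : Nonempty V := Fintype.card_pos_iff.1 (by omega)
  obtain ⟨x, y, z, hxy, hxz, hyz, hv⟩ := hG.exists_neighbors v
  have hvx : G.Adj v x := (hv x).2 (by simp)
  have hvy : G.Adj v y := (hv y).2 (by simp)
  have hvz : G.Adj v z := (hv z).2 (by simp)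
  obtain ⟨u, w, huw, hcompl⟩ := Finset.card_eq_two.1 (show ({v, x, y, z} : Finset V)ᶜ.card = 2 by
    rw [Finset.card_compl, hV]
    simp [hvx.ne, hvy.ne, hvz.ne, hxy, hxz, hyz])
  have hall : ∀ t, t = v ∨ t = x ∨ t = y ∨ t = z ∨ t = u ∨ t = w := fun t => by
    have : t ∈ ({v, x, y, z} : Finset V) ∨ t ∈ ({u, w} : Finset V) := by
      rw [← hcompl, Finset.mem_compl]
      exact em _
    simpa [or_assoc] using this
  -- Neighbours of `v` are pairwise nonadjacent, which leaves exactly `v`, `u`, `w` as neighbours of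
  -- each of them.
  have hx := hG.adj_of_subset (v := x) (a := v) (b := u) (c := w) fun t ht => by
    rcases hall t with rfl | rfl | rfl | rfl | rfl | rfl
    · simp
    · exact absurd rfl ht.ne
    · exact absurd hvy (htri _ _ _ hvx ht)
    · exact absurd hvz (htri _ _ _ hvx ht)
    · simp
    · simp
  have hy := hG.adj_of_subset (v := y) (a := v) (b := u) (c := w) fun t ht => by
    rcases hall t with rfl | rfl | rfl | rfl | rfl | rfl
    · simp
    · exact absurd hvx (htri _ _ _ hvy ht)
    · exact absurd rfl ht.ne
    · exact absurd hvz (htri _ _ _ hvy ht)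
    · simp
    · simp
  have hz := hG.adj_of_subset (v := z) (a := v) (b := u) (c := w) fun t ht => by
    rcases hall t with rfl | rfl | rfl | rfl | rfl | rfl
    · simp
    · exact absurd hvx (htri _ _ _ hvz ht)
    · exact absurd hvy (htri _ _ _ hvz ht)
    · exact absurd rfl ht.ne
    · simp
    · simp
  let f : Fin 3 ⊕ Fin 3 → V := Sum.elim ![v, u, w] ![x, y, z]
  have hedge : ∀ i j, G.Adj (f (.inl i)) (f (.inr j)) := by
    intro i j
    fin_cases i <;> fin_cases j <;> simp [f, hvx, hvy, hvz, hx, hy, hz, G.adj_comm u, G.adj_comm w]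
  refine nonempty_iso_of_regular hG isRegularOfDegree_completeBipartiteGraph
    ⟨f, fun {i j} hij => ?_⟩ ((Fintype.bijective_iff_surjective_and_card f).2 ⟨fun t => ?_, ?_⟩)
  · rcases i with i | i <;> rcases j with j | j
    · simp at hij
    · exact hedge i j
    · exact (hedge j i).symm
    · simp at hij
  · rcases hall t with rfl | rfl | rfl | rfl | rfl | rfl
    exacts [⟨.inl 0, rfl⟩, ⟨.inr 0, rfl⟩, ⟨.inr 1, rfl⟩, ⟨.inr 2, rfl⟩, ⟨.inl 1, rfl⟩,
      ⟨.inl 2, rfl⟩]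
  · simp [hV]

/-- A cubic graph on six vertices with a triangle is the prism. -/
lemma IsRegularOfDegree.nonempty_iso_prism (hG : G.IsRegularOfDegree 3)
    (hV : Fintype.card V = 6) {a b c : V} (hab : G.Adj a b) (hbc : G.Adj b c) (hac : G.Adj a c) :
    Nonempty (G ≃g (⊤ : SimpleGraph (Fin 2)).boxProd (⊤ : SimpleGraph (Fin 3))) := by
  classical
  set S : Finset V := {a, b, c} with hS
  have hScard : S.card = 3 := by simp [hS, hab.ne, hbc.ne, hac.ne]
  have hclique : ∀ s ∈ S, ∀ t ∈ S, s ≠ t → G.Adj s t := by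
    intro s hs t ht hst
    simp only [hS, Finset.mem_insert, Finset.mem_singleton] at hs ht
    rcases hs with rfl | rfl | rfl <;> rcases ht with rfl | rfl | rfl <;>
      first | exact absurd rfl hst | assumption | (apply Adj.symm; assumption)
  obtain ⟨d, e, f, hde, hdf, hef, hcompl⟩ := Finset.card_eq_three.1 (show Sᶜ.card = 3 by
    rw [Finset.card_compl, hV, hScard])
  have hall : ∀ t, t ∈ S ∨ t = d ∨ t = e ∨ t = f := fun t => by
    have : t ∈ S ∨ t ∈ Sᶜ := by
      rw [Finset.mem_compl]
      exact em _
    rw [hcompl] at this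
    simpa using this
  have hout : ∀ t, t ∉ S ↔ t = d ∨ t = e ∨ t = f := fun t => by
    rw [← Finset.mem_compl, hcompl]
    simp
  have hdS : d ∉ S := (hout d).2 (by simp)
  have heS : e ∉ S := (hout e).2 (by simp)
  have hfS : f ∉ S := (hout f).2 (by simp)
  -- every vertex outside the triangle has a neighbour in it
  have hex : ∀ t, t ∉ S → ∃ s ∈ S, G.Adj t s := by
    intro t ht
    by_contra! hno
    have hsub : G.neighborFinset t ⊆ Sᶜ.erase t := fun r hr => by
      rw [mem_neighborFinset] at hr
      rw [Finset.mem_erase, Finset.mem_compl]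
      exact ⟨hr.ne', fun hrS => hno r hrS hr⟩
    have := Finset.card_le_card hsub
    rw [card_neighborFinset_eq_degree, hG, Finset.card_erase_of_mem (Finset.mem_compl.2 ht),
      Finset.card_compl, hV, hScard] at this
    omega
  -- and a vertex of the triangle has only one neighbour outside
  have hone : ∀ s ∈ S, ∀ t t', t ∉ S → t' ∉ S → G.Adj s t → G.Adj s t' → t' = t := by
    intro s hs t t' ht ht' hst hst'
    obtain ⟨m, n, hmn, hSmn⟩ := Finset.card_eq_two.1 (show (S.erase s).card = 2 by
      rw [Finset.card_erase_of_mem hs, hScard])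
    have hm : m ∈ S.erase s := by rw [hSmn]; simp
    have hn : n ∈ S.erase s := by rw [hSmn]; simp
    rw [Finset.mem_erase] at hm hn
    rcases hG.eq_of_adj hmn (ne_of_mem_of_not_mem hm.2 ht) (ne_of_mem_of_not_mem hn.2 ht)
      (hclique s hs m hm.2 hm.1.symm) (hclique s hs n hn.2 hn.1.symm) hst hst' with h | h | h
    · exact absurd (h ▸ hm.2) ht'
    · exact absurd (h ▸ hn.2) ht'
    · exact h
  obtain ⟨p, hp, hdp⟩ := hex d hdS
  obtain ⟨q, hq, heq⟩ := hex e heS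
  obtain ⟨r, hr, hfr⟩ := hex f hfS
  have hpq : p ≠ q := by
    rintro rfl
    exact hde (hone p hp e d heS hdS heq.symm hdp.symm)
  have hpr : p ≠ r := by
    rintro rfl
    exact hdf (hone p hp f d hfS hdS hfr.symm hdp.symm)
  have hqr : q ≠ r := by
    rintro rfl
    exact hef (hone q hq f e hfS heS hfr.symm heq.symm)
  have hSpqr : S = {p, q, r} := by
    symm
    refine Finset.eq_of_subset_of_card_le ?_ ?_
    · intro t ht
      simp only [Finset.mem_insert, Finset.mem_singleton] at ht
      rcases ht with rfl | rfl | rfl <;> assumption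
    · rw [hScard]
      simp [hpq, hpr, hqr]
  have hall' : ∀ t, t = p ∨ t = q ∨ t = r ∨ t = d ∨ t = e ∨ t = f := fun t => by
    have := hall t
    rw [hSpqr] at this
    simpa [or_assoc] using this
  have hd := hG.adj_of_subset (v := d) (a := p) (b := e) (c := f) fun t ht => by
    rcases hall' t with rfl | rfl | rfl | rfl | rfl | rfl
    · simp
    · exact absurd (hone t hq d e hdS heS ht.symm heq.symm) hde.symm
    · exact absurd (hone t hr d f hdS hfS ht.symm hfr.symm) hdf.symm
    · exact absurd rfl ht.ne
    · simp
    · simp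
  have he := hG.adj_of_subset (v := e) (a := q) (b := d) (c := f) fun t ht => by
    rcases hall' t with rfl | rfl | rfl | rfl | rfl | rfl
    · exact absurd (hone t hp e d heS hdS ht.symm hdp.symm) hde
    · simp
    · exact absurd (hone t hr e f heS hfS ht.symm hfr.symm) hef.symm
    · simp
    · exact absurd rfl ht.ne
    · simp
  have hpq' := hclique p hp q hq hpq
  have hpr' := hclique p hp r hr hpr
  have hqr' := hclique q hq r hr hqr
  let F : Fin 2 × Fin 3 → V := fun z => ![![p, q, r], ![d, e, f]] z.1 z.2
  refine nonempty_iso_of_regular hG isRegularOfDegree_prism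
    ⟨F, fun {i j} hij => ?_⟩ ((Fintype.bijective_iff_surjective_and_card F).2 ⟨fun t => ?_, ?_⟩)
  · obtain ⟨k, i⟩ := i
    obtain ⟨l, j⟩ := j
    rw [boxProd_adj] at hij
    rcases hij with ⟨hkl, rfl : i = j⟩ | ⟨hij, rfl : k = l⟩
    · fin_cases k <;> fin_cases l <;> fin_cases i <;>
        first
        | exact absurd rfl hkl
        | simp [F, hdp, heq, hfr, hdp.symm, heq.symm, hfr.symm]
    · fin_cases k <;> fin_cases i <;> fin_cases j <;>
        first
        | exact absurd rfl hij
        | simp [F, hpq', hpr', hqr', hpq'.symm, hpr'.symm, hqr'.symm, hd.2.1, hd.2.2, he.2.2,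
            hd.2.1.symm, hd.2.2.symm, he.2.2.symm]
  · rcases hall' t with rfl | rfl | rfl | rfl | rfl | rfl
    exacts [⟨(0, 0), rfl⟩, ⟨(0, 1), rfl⟩, ⟨(0, 2), rfl⟩, ⟨(1, 0), rfl⟩, ⟨(1, 1), rfl⟩,
      ⟨(1, 2), rfl⟩]
  · simp [hV]

theorem IsRegularOfDegree.nonempty_iso_of_isRigid [Nonempty V] (hG : G.IsRegularOfDegree 3)
    (hr : G.IsRigid) :
    Nonempty (G ≃g (⊤ : SimpleGraph (Fin 4))) ∨
      Nonempty (G ≃g completeBipartiteGraph (Fin 3) (Fin 3)) ∨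
      Nonempty (G ≃g (⊤ : SimpleGraph (Fin 2)).boxProd (⊤ : SimpleGraph (Fin 3))) := by
  classical
  obtain ⟨p, hp, hpr⟩ := hr
  have h4 := hG.four_le_card
  obtain ⟨u, w, huw⟩ := Fintype.exists_pair_of_one_lt_card (show 1 < Fintype.card V by omega)
  have h1 := hp.card_edgeSet G hpr huw
  have h2 := hG.three_mul_card
  rw [Nat.card_eq_fintype_card] at h2
  -- The edge bound and $3|V|=2|E|$ give $|V|\le 6$, and parity excludes 5.
  obtain hV | hV : Fintype.card V = 4 ∨ Fintype.card V = 6 := by omega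
  · exact .inl (hG.nonempty_iso_top hV)
  · right
    by_cases htri : ∀ a b c, G.Adj a b → G.Adj b c → ¬ G.Adj a c
    · exact .inl (hG.nonempty_iso_completeBipartiteGraph hV htri)
    · push Not at htri
      obtain ⟨a, b, c, hab, hbc, hac⟩ := htri
      exact .inr (hG.nonempty_iso_prism hV hab hbc hac)

end Cubic

lemma not_isGloballyRigid_completeBipartiteGraph :
    ¬ (completeBipartiteGraph (Fin 3) (Fin 3)).IsGloballyRigid := fun ⟨_, hp, h⟩ =>
  hp.not_globallyRigid_completeBipartiteGraph h

lemma not_isGloballyRigid_prism :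
    ¬ ((⊤ : SimpleGraph (Fin 2)).boxProd (⊤ : SimpleGraph (Fin 3))).IsGloballyRigid :=
  fun ⟨_, hp, h⟩ => hp.not_globallyRigid_prism h

end SimpleGraph

theorem lemma5p1 {V : Type*} [Finite V] [Nonempty V] (G : SimpleGraph V) [G.LocallyFinite] :
    ((G.IsRegularOfDegree 3 ∧ G.IsGloballyRigid) ↔
      Nonempty (G ≃g (⊤ : SimpleGraph (Fin 4)))) ∧
    ((G.IsRegularOfDegree 3 ∧ G.IsRigid ∧ ¬ G.IsGloballyRigid) ↔
      (Nonempty (G ≃g completeBipartiteGraph (Fin 3) (Fin 3)) ∨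
        Nonempty (G ≃g (SimpleGraph.boxProd (⊤ : SimpleGraph (Fin 2)) (⊤ : SimpleGraph (Fin 3)))))) := by
  classical
  cases nonempty_fintype V
  refine ⟨⟨fun ⟨hG, hg⟩ => ?_, fun ⟨e⟩ => ?_⟩, ⟨fun ⟨hG, hr, hg⟩ => ?_, ?_⟩⟩
  · rcases hG.nonempty_iso_of_isRigid hg.isRigid with h | ⟨⟨e⟩⟩ | ⟨⟨e⟩⟩
    · exact h
    · exact absurd (e.symm.isGloballyRigid hg)
        SimpleGraph.not_isGloballyRigid_completeBipartiteGraph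
    · exact absurd (e.symm.isGloballyRigid hg) SimpleGraph.not_isGloballyRigid_prism
  · exact ⟨.of_iso e SimpleGraph.isRegularOfDegree_top_four,
      e.isGloballyRigid (SimpleGraph.isGloballyRigid_top _)⟩
  · rcases hG.nonempty_iso_of_isRigid hr with ⟨⟨e⟩⟩ | h
    · exact absurd (e.isGloballyRigid (SimpleGraph.isGloballyRigid_top _)) hg
    · exact h
  · rintro (⟨⟨e⟩⟩ | ⟨⟨e⟩⟩)
    · exact ⟨.of_iso e SimpleGraph.isRegularOfDegree_completeBipartiteGraph,
        e.isRigid SimpleGraph.isRigid_completeBipartiteGraph,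
        fun hg => SimpleGraph.not_isGloballyRigid_completeBipartiteGraph
          (e.symm.isGloballyRigid hg)⟩
    · exact ⟨.of_iso e SimpleGraph.isRegularOfDegree_prism,
        e.isRigid SimpleGraph.isRigid_prism,
        fun hg => SimpleGraph.not_isGloballyRigid_prism (e.symm.isGloballyRigid hg)⟩
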